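/- **Proposition (Regularity).** Let $p\in[2,3)$, $T>0$, $J=[0,T]$ and $m,d,k\in\mathbb N$. For a function $A=(A_{s,t})$ of two times and $q\ge 1$ put $\|A\|_{q}:=\big(\sup_{\mathcal D}\sum_{i}|A_{t_i,t_{i+1}}|^{q}\big)^{1/q}$, the supremum being over all partitions $\mathcal D=\{0=t_0\le\dots\le t_n=T\}$ of $J$; for a path $Y$ put $Y_{s,t}:=Y_t-Y_s$ and $\|Y\|_q:=\|(Y_{s,t})\|_q$. A *rough path* $\boldsymbol\zeta=(\zeta,\zeta^{(2)})\in\mathscr C^p(J,\mathbb R^d)$ consists of $\zeta:J\to\mathbb R^d$ and $\zeta^{(2)}_{s,t}\in\mathbb R^d\otimes\mathbb R^d$ ($0\le s\le t\le T$) such that $\zeta^{(2)}_{s,t}=\zeta^{(2)}_{s,r}+\zeta^{(2)}_{r,t}+\zeta_{s,r}\otimes\zeta_{r,t}$ for $s\le r\le t$ and $$|||\boldsymbol\zeta|||_{1/p\text{-Höl}}:=\sup_{s<t}\frac{|\zeta_{s,t}|}{|t-s|^{1/p}}+\sup_{s<t}\frac{|\zeta^{(2)}_{s,t}|}{|t-s|^{2/p}}<\infty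 .$$ A pair $(Y,Y')$ of continuous paths of finite $p$-variation, $Y$ with values in a normed space $V$ and $Y'$ with values in $\mathcal L(\mathbb R^d,V)$, is *controlled by* $\zeta$ if the remainder $R^Y_{s,t}:=Y_{s,t}-Y'_s\zeta_{s,t}$ has finite $p/2$-variation. If $Y$ takes values in $\mathcal L(\mathbb R^d,\mathbb R^m)$, then $\int_0^tY_r\,d\boldsymbol\zeta_r:=\lim\sum_i\big[Y_{t_i}\zeta_{t_i,t_{i+1}}+Y'_{t_i}\zeta^{(2)}_{t_i,t_{i+1}}\big]$, the limit being over partitions of $[0,t]$ with mesh tending to $0$; here $Y'_{r}(u\otimes v)=(Y'_{r}u)v$. Let $b:\mathbb R^m\times\mathbb R^k\to\mathbb R^m$ be bounded and Lipschitz. Let $\lambda:\mathbb R^m\times\mathbb R^k\to\mathcal L(\mathbb R^d,\mathbb R^m)$ and $\psi:\mathbb R^m\times\mathbb R^k\to W$ be of class $C^2_b$ (twice continuously differentiable, bounded together with their derivatives of orders one and two), where $W$ is a normed space, for example $W=\mathcal L(\mathbb R^d,\mathbb R^n)$. Let $|||\boldsymbol\zeta|||_{1/p\text{-Höl}}\le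 M<\infty$ and let $\gamma:J\to\mathbb R^k$ be continuous of finite $p/2$-variation. Let $X:J\to\mathbb R^m$ be a solution of $$dX_s=b(X_s,\gamma_s)\,ds+\lambda(X_s,\gamma_s)\,d\boldsymbol\zeta_s,\qquad X_0=x_0,$$ that is, the pair $(X,X')$ with $X':=\lambda(X,\gamma)$ is controlled by $\zeta$ and $X_t=x_0+\int_0^tb(X_s,\gamma_s)\,ds+\int_0^t\lambda(X_s,\gamma_s)\,d\boldsymbol\zeta_s$ for all $t\in J$, where $\lambda(X,\gamma)$ has Gubinelli derivative $\lambda(X,\gamma)'=\partial_x\lambda(X,\gamma)X'$. Put $\psi(X,\gamma)':=\partial_x\psi(X,\gamma)X'$ and $R^\psi_{s,t}:=\psi(X,\gamma)_{s,t}-\psi(X,\gamma)'_s\,\zeta_{s,t}$. Then there is a constant $C>0$, depending only on $p,T,M$, the dimensions and a common bound $K$ for $\|b\|_\infty$, the Lipschitz constant of $b$, and the suprema of $\lambda,\psi$ and their derivatives up to order two (so not on $\boldsymbol\zeta,\gamma,x_0,X$ otherwise), such that 1. $\|\psi(X,\gamma)'\|_{p}\le C\big(\|X\|_{p}+\|\gamma\|_{p/2}\big)$;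 2. $\|R^\psi\|_{p/2}\le C\big(\|X\|_{p}^2+\|R^X\|_{p/2}+\|\gamma\|_{p/2}\big)$; 3. $\|X\|_{p}\le C\big(1+\|\gamma\|_{p/2}^{1+p}\big)$; 4. $\|R^X\|_{p/2}\le C\big(1+\|\gamma\|_{p/2}^{2+p}\big)$. -/

import Mathlib

open scoped NNReal ENNReal

/-- The state space `ℝⁿ` with its Euclidean norm. -/
abbrev RSpace (n : ℕ) : Type := EuclideanSpace ℝ (Fin n)

/-- `ℝᵈ ⊗ ℝᵈ`, realised as `d × d` arrays with the Euclidean (Frobenius) norm. -/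
abbrev RTensor (d : ℕ) : Type := EuclideanSpace ℝ (Fin d × Fin d)

/-- The tensor `u ⊗ v`, with entries `uᵢ vⱼ`. -/
noncomputable def outerProd {d : ℕ} (u v : RSpace d) : RTensor d :=
  WithLp.toLp 2 (fun ij : Fin d × Fin d => u ij.1 * v ij.2)

/-- The action of a bilinear map `A ∈ L(ℝᵈ, L(ℝᵈ, W))` on a tensor: the linear extension of
`u ⊗ v ↦ A u v`. -/
noncomputable def applyTensor {d : ℕ} {W : Type*} [NormedAddCommGroup W] [NormedSpace ℝ W]
    (A : RSpace d →L[ℝ] (RSpace d →L[ℝ] W)) (S : RTensor d) : W :=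
  ∑ i : Fin d, ∑ j : Fin d,
    S (i, j) • A (EuclideanSpace.single i (1 : ℝ)) (EuclideanSpace.single j (1 : ℝ))

/-- A partition `a = t₀ ≤ t₁ ≤ ⋯ ≤ tₙ = b`. Repeated points are harmless: they contribute zero to
all the sums below, since the two-parameter functions involved vanish on the diagonal. -/
structure IntervalPartition (a b : ℝ) where
  n : ℕ
  t : ℕ → ℝ
  t_zero : t 0 = a
  t_last : t n = b
  mono : ∀ i < n, t i ≤ t (i + 1)

/-- The increment `X_{s,t} = X_t - X_s`. -/
def pathIncr {W : Type*} [NormedAddCommGroup W] (X : ℝ → W) (s t : ℝ) : W := X t - X s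

/-- The `q`-variation over `[a, b]` of a two-parameter function, with values in `[0, ∞]`. -/
noncomputable def qVar {W : Type*} [NormedAddCommGroup W] (q : ℝ) (A : ℝ → ℝ → W)
    (a b : ℝ) : ℝ≥0∞ :=
  (⨆ D : IntervalPartition a b,
    ∑ i ∈ Finset.range D.n, ‖A (D.t i) (D.t (i + 1))‖ₑ ^ q) ^ (1 / q)

/-- The `α`-Hölder seminorm over `[0, T]` of a two-parameter function on `0 ≤ s ≤ t ≤ T`. -/
noncomputable def holderSeminorm {W : Type*} [NormedAddCommGroup W] (α : ℝ) (A : ℝ → ℝ → W)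
    (T : ℝ) : ℝ≥0∞ :=
  ⨆ (s : ℝ) (t : ℝ) (_ : 0 ≤ s) (_ : s < t) (_ : t ≤ T),
    ‖A s t‖ₑ / (ENNReal.ofReal (t - s)) ^ α

/-- The rough path Hölder norm `‖ζ‖_{1/p} + ‖ζ⁽²⁾‖_{2/p}` of a rough path. -/
noncomputable def roughHolderNorm {d : ℕ} (p T : ℝ) (ζ : ℝ → RSpace d)
    (ζ2 : ℝ → ℝ → RTensor d) : ℝ≥0∞ :=
  holderSeminorm (1 / p) (pathIncr ζ) T + holderSeminorm (2 / p) ζ2 T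

/-- `(ζ, ζ⁽²⁾)` is a `1/p`-Hölder rough path on `[0, T]`: Chen's relation holds and the rough
Hölder norm is finite. Only values at times `0 ≤ s ≤ t ≤ T` matter. -/
structure IsRoughPath {d : ℕ} (p T : ℝ) (ζ : ℝ → RSpace d) (ζ2 : ℝ → ℝ → RTensor d) : Prop where
  chen : ∀ s r t : ℝ, 0 ≤ s → s ≤ r → r ≤ t → t ≤ T →
    ζ2 s t = ζ2 s r + ζ2 r t + outerProd (pathIncr ζ s r) (pathIncr ζ r t)
  holder : roughHolderNorm p T ζ ζ2 < ⊤

/-- Continuous paths `[0, T] → W` of finite `q`-variation. -/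
def IsQVarPath {W : Type*} [NormedAddCommGroup W] (q T : ℝ) (X : ℝ → W) : Prop :=
  ContinuousOn X (Set.Icc 0 T) ∧ qVar q (pathIncr X) 0 T < ⊤

/-- The remainder `R^Y_{s,t} = Y_{s,t} - Y'_s ζ_{s,t}`. -/
noncomputable def pathRemainder {d : ℕ} {W : Type*} [NormedAddCommGroup W] [NormedSpace ℝ W]
    (ζ : ℝ → RSpace d) (Y : ℝ → W) (Y' : ℝ → (RSpace d →L[ℝ] W)) (s t : ℝ) : W :=
  pathIncr Y s t - Y' s (pathIncr ζ s t)

/-- `(Y, Y')` is a path controlled by `ζ` on `[0, T]`. -/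
structure IsControlledPath {d : ℕ} {W : Type*} [NormedAddCommGroup W] [NormedSpace ℝ W]
    (p T : ℝ) (ζ : ℝ → RSpace d) (Y : ℝ → W) (Y' : ℝ → (RSpace d →L[ℝ] W)) : Prop where
  path : IsQVarPath p T Y
  deriv : IsQVarPath p T Y'
  remainder : qVar (p / 2) (pathRemainder ζ Y Y') 0 T < ⊤

/-- The compensated Riemann sum `∑ (Y_{tᵢ} ζ_{tᵢ,tᵢ₊₁} + Y'_{tᵢ} ζ⁽²⁾_{tᵢ,tᵢ₊₁})`. -/
noncomputable def roughSum {d : ℕ} {W : Type*} [NormedAddCommGroup W] [NormedSpace ℝ W]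
    (ζ : ℝ → RSpace d) (ζ2 : ℝ → ℝ → RTensor d) (Y : ℝ → (RSpace d →L[ℝ] W))
    (Y' : ℝ → (RSpace d →L[ℝ] (RSpace d →L[ℝ] W))) {a b : ℝ} (D : IntervalPartition a b) : W :=
  ∑ i ∈ Finset.range D.n,
    (Y (D.t i) (pathIncr ζ (D.t i) (D.t (i + 1)))
      + applyTensor (Y' (D.t i)) (ζ2 (D.t i) (D.t (i + 1))))

/-- `I = ∫_a^b Y dζ`: the compensated Riemann sums converge to `I` as the mesh tends to zero. -/
def IsRoughIntegral {d : ℕ} {W : Type*} [NormedAddCommGroup W] [NormedSpace ℝ W]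
    (ζ : ℝ → RSpace d) (ζ2 : ℝ → ℝ → RTensor d) (Y : ℝ → (RSpace d →L[ℝ] W))
    (Y' : ℝ → (RSpace d →L[ℝ] (RSpace d →L[ℝ] W))) (a b : ℝ) (I : W) : Prop :=
  ∀ ε > 0, ∃ δ > 0, ∀ D : IntervalPartition a b,
    (∀ i < D.n, D.t (i + 1) - D.t i < δ) → ‖roughSum ζ ζ2 Y Y' D - I‖ < ε

/-- `f ∈ C²_b`, with `f` and its derivatives of orders one and two bounded by `K`. -/
def IsC2Bounded {V W : Type*} [NormedAddCommGroup V] [NormedSpace ℝ V] [NormedAddCommGroup W]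
    [NormedSpace ℝ W] (K : ℝ≥0) (f : V → W) : Prop :=
  ContDiff ℝ 2 f ∧ ∀ i ≤ 2, ∀ z : V, ‖iteratedFDeriv ℝ i f z‖ ≤ K

/-- `f ∈ Lip_b`, with Lipschitz constant and supremum bounded by `K`. -/
def IsLipBounded {V W : Type*} [NormedAddCommGroup V] [NormedAddCommGroup W]
    (K : ℝ≥0) (f : V → W) : Prop :=
  LipschitzWith K f ∧ ∀ z : V, ‖f z‖ ≤ K

/-- The path `φ(X, γ)`. -/
def compPath {m k : ℕ} {W : Type*} (φ : RSpace m × RSpace k → W) (X : ℝ → RSpace m)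
    (γ : ℝ → RSpace k) (t : ℝ) : W := φ (X t, γ t)

/-- The Gubinelli derivative `φ(X, γ)' = ∂ₓφ(X, γ) X'`. -/
noncomputable def compDeriv {m k d : ℕ} {W : Type*} [NormedAddCommGroup W] [NormedSpace ℝ W]
    (φ : RSpace m × RSpace k → W) (X : ℝ → RSpace m) (X' : ℝ → (RSpace d →L[ℝ] RSpace m))
    (γ : ℝ → RSpace k) (t : ℝ) : RSpace d →L[ℝ] W :=
  (fderiv ℝ (fun x : RSpace m => φ (x, γ t)) (X t)).comp (X' t)

/-- `X` solves `dX = b(X, γ) ds + σ(X, γ) dζ`, `X₀ = x₀` on `[0, T]`: the pair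
`(X, X') = (X, σ(X, γ))` is controlled by `ζ`, and the integrated equation holds, where the
rough integral is that of `σ(X, γ)` with Gubinelli derivative `∂ₓσ(X, γ) X'`. -/
structure IsRDESolution {m d k : ℕ} (p T : ℝ) (b : RSpace m × RSpace k → RSpace m)
    (σ : RSpace m × RSpace k → (RSpace d →L[ℝ] RSpace m))
    (ζ : ℝ → RSpace d) (ζ2 : ℝ → ℝ → RTensor d) (γ : ℝ → RSpace k)
    (x₀ : RSpace m) (X : ℝ → RSpace m) : Prop where
  controlled : IsControlledPath p T ζ X (compPath σ X γ)
  equation : ∀ t ∈ Set.Icc 0 T,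
    IsRoughIntegral ζ ζ2 (compPath σ X γ) (compDeriv σ X (compPath σ X γ) γ) 0 t
      (X t - x₀ - ∫ s in (0 : ℝ)..t, b (X s, γ s))

/-!
The estimates on `ψ(X, γ)` are deterministic calculus: `ψ(X, γ)'` is a Lipschitz function of
`(X, γ)`, and a Taylor expansion in `x` bounds the remainder of `ψ(X, γ)` by `|X_{s,t}|²`, the
remainder of `X` and `|γ_{s,t}|` (`qVar_compDeriv_le`, `qVar_pathRemainder_comp_le`). Both hold on
every subinterval.

The bounds on `X` rest on the sewing estimate `norm_sum_sub_le_of_rootControl`. By Chen's relation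
the local expansion `Y_s ζ_{s,t} + Y'_s ζ⁽²⁾_{s,t}` of the integral of `Y = σ(X, γ)` is additive up
to `R^Y_{s,u} ζ_{u,t} + Y'_{s,u} ζ⁽²⁾_{u,t}`, which is bounded by the power `3 / p > 1` of a
control; hence the integral over `[s, t]` differs from its expansion by a multiple of
`‖R^Y‖_{p/2} h^{1/p} + ‖Y'‖_p h^{2/p}`, where `h = t - s`. Inserting the estimates for `ψ = σ` gives
on `[s, t]`
`‖R^X‖_{p/2} ≤ c ((1 + ‖X‖_p + ‖γ‖_{p/2}) h^{2/p} + (‖X‖_p² + ‖R^X‖_{p/2} + ‖γ‖_{p/2}) h^{1/p})`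
(`IsRDESolution.qVar_pathRemainder_le`), and on short intervals the remainder on the right-hand side
is absorbed.

Since `X` and `R^X` differ by a `1/p`-Hölder function, this yields
`|X_{s,t}| ≤ c h^{1/p} (1 + ‖γ‖_{p/2} + ‖X‖_{p;[s,t]}²)`. As the right-hand side is finite, `X` is
`1/p`-Hölder continuous with some constant, and a continuity argument in the length of the interval
(`HolderUpTo.bootstrap`) replaces this constant by a multiple of `1 + ‖γ‖_{p/2}` on intervals of
length at most a multiple of `(1 + ‖γ‖_{p/2})^{-p/2}`. Concatenating such intervals gives
`‖X‖_p ≤ C (1 + ‖γ‖_{p/2})^{(p+1)/2}` (`LocalBounds.path_le`), and the local bound for the remainder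
then gives `‖R^X‖_{p/2} ≤ C (1 + ‖γ‖_{p/2})^{p+1}` (`LocalBounds.remainder_le_signal`). Both are
stronger than required.
-/

/-! ### Partitions -/

namespace IntervalPartition

variable {a b c : ℝ}

lemma le_of_le (D : IntervalPartition a b) {i j : ℕ} (hij : i ≤ j) (hj : j ≤ D.n) :
    D.t i ≤ D.t j := by
  induction j, hij using Nat.le_induction with
  | base => exact le_rfl
  | succ j _ ih => exact (ih (by omega)).trans (D.mono j (by omega))

lemma left_le (D : IntervalPartition a b) {i : ℕ} (hi : i ≤ D.n) : a ≤ D.t i := by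
  simpa only [D.t_zero] using D.le_of_le (Nat.zero_le i) hi

lemma le_right (D : IntervalPartition a b) {i : ℕ} (hi : i ≤ D.n) : D.t i ≤ b := by
  simpa only [D.t_last] using D.le_of_le hi le_rfl

/-- The partition of `[a, b]` into `n` intervals of equal length. -/
noncomputable def uniform (hab : a ≤ b) {n : ℕ} (hn : 0 < n) : IntervalPartition a b where
  n := n
  t i := a + i * ((b - a) / n)
  t_zero := by simp
  t_last := by
    have : (n : ℝ) ≠ 0 := by positivity
    field_simp
    ring
  mono i _ := by
    have : 0 ≤ (b - a) / n := div_nonneg (by linarith) (by positivity)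
    push_cast
    linarith

lemma exists_mesh_lt (hab : a ≤ b) {δ : ℝ} (hδ : 0 < δ) :
    ∃ D : IntervalPartition a b, ∀ i < D.n, D.t (i + 1) - D.t i < δ := by
  obtain ⟨n, hn⟩ := exists_nat_gt ((b - a) / δ)
  have hn0 : (0 : ℝ) < n := lt_of_le_of_lt (div_nonneg (by linarith) hδ.le) hn
  refine ⟨uniform hab (Nat.cast_pos.mp hn0), fun i _ => ?_⟩
  have h1 : (b - a) / n < δ := by
    rw [div_lt_iff₀ hδ] at hn
    rw [div_lt_iff₀ hn0]
    linarith
  simp only [uniform]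
  push_cast
  linarith

lemma nonempty (hab : a ≤ b) : Nonempty (IntervalPartition a b) :=
  ⟨uniform hab one_pos⟩

/-- A partition of `[a, b]` followed by one of `[b, c]`. -/
def concat (D : IntervalPartition a b) (E : IntervalPartition b c) : IntervalPartition a c where
  n := D.n + E.n
  t i := if i ≤ D.n then D.t i else E.t (i - D.n)
  t_zero := by simp [D.t_zero]
  t_last := by
    by_cases h : E.n = 0
    · have h0 := E.t_zero
      have h1 := E.t_last
      rw [h] at h1
      simp [h, D.t_last, ← h0, h1]
    · simp [h, E.t_last]
  mono i hi := by
    rcases lt_trichotomy i D.n with h | h | h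
    · simpa [h.le, Nat.succ_le_of_lt h] using D.mono i h
    · subst h
      simpa [D.t_last, E.t_zero] using E.mono 0 (by omega)
    · have := E.mono (i - D.n) (by omega)
      rw [if_neg (by omega), if_neg (by omega)]
      rwa [show i + 1 - D.n = i - D.n + 1 by omega]

lemma sum_concat {M : Type*} [AddCommMonoid M] (D : IntervalPartition a b)
    (E : IntervalPartition b c) (f : ℝ → ℝ → M) :
    ∑ i ∈ Finset.range (D.concat E).n, f ((D.concat E).t i) ((D.concat E).t (i + 1)) =
      ∑ i ∈ Finset.range D.n, f (D.t i) (D.t (i + 1)) +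
        ∑ i ∈ Finset.range E.n, f (E.t i) (E.t (i + 1)) := by
  change ∑ i ∈ Finset.range (D.n + E.n), _ = _
  rw [Finset.sum_range_add]
  congr 1
  · refine Finset.sum_congr rfl fun i hi => ?_
    have hi := Finset.mem_range.mp hi
    simp [concat, hi.le, Nat.succ_le_of_lt hi]
  · refine Finset.sum_congr rfl fun i _ => ?_
    rcases Nat.eq_zero_or_pos i with rfl | h
    · simp [concat, D.t_last, E.t_zero]
    · simp only [concat]
      rw [if_neg (by omega), if_neg (by omega)]
      congr 2 <;> omega

lemma concat_mesh_lt (D : IntervalPartition a b) (E : IntervalPartition b c) {δ : ℝ}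
    (hD : ∀ i < D.n, D.t (i + 1) - D.t i < δ) (hE : ∀ i < E.n, E.t (i + 1) - E.t i < δ) :
    ∀ i < (D.concat E).n, (D.concat E).t (i + 1) - (D.concat E).t i < δ := by
  intro i hi
  have hi : i < D.n + E.n := hi
  simp only [concat]
  rcases lt_trichotomy i D.n with h | h | h
  · simpa [h.le, Nat.succ_le_of_lt h] using hD i h
  · subst h
    simpa [D.t_last, E.t_zero] using hE 0 (by omega)
  · have := hE (i - D.n) (by omega)
    rw [if_neg (by omega), if_neg (by omega)]
    rwa [show i + 1 - D.n = i - D.n + 1 by omega]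

end IntervalPartition

/-! ### Variation bounds and controls -/

section Variation

variable {q a b c : ℝ} {f g : ℝ → ℝ → ℝ}

/-- The nonnegative two-parameter function `f` has `q`-variation at most `c` over `[a, b]`. -/
def VariationLE (q : ℝ) (f : ℝ → ℝ → ℝ) (a b c : ℝ) : Prop :=
  ∀ D : IntervalPartition a b, ∑ i ∈ Finset.range D.n, f (D.t i) (D.t (i + 1)) ^ q ≤ c ^ q

/-- `f` is nonnegative and `f ^ q` is superadditive on `[a, b]`; in other words `f` is the `q`-th
root of a control function. The `q`-variation of a two-parameter function over variable
subintervals is of this kind, and so is `(s, t) ↦ (t - s) ^ (1 / q)`. -/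
structure RootControl (q : ℝ) (f : ℝ → ℝ → ℝ) (a b : ℝ) : Prop where
  nonneg : ∀ s t, a ≤ s → s ≤ t → t ≤ b → 0 ≤ f s t
  superadd : ∀ s u t, a ≤ s → s ≤ u → u ≤ t → t ≤ b → f s u ^ q + f u t ^ q ≤ f s t ^ q

lemma VariationLE.mono (hq : 0 < q) (h : VariationLE q g a b c)
    (hfg : ∀ s t, a ≤ s → s ≤ t → t ≤ b → 0 ≤ f s t ∧ f s t ≤ g s t) : VariationLE q f a b c := by
  refine fun D => (Finset.sum_le_sum fun i hi => ?_).trans (h D)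
  have hi := Finset.mem_range.mp hi
  obtain ⟨h0, h1⟩ := hfg _ _ (D.left_le hi.le) (D.mono i hi) (D.le_right (Nat.succ_le_of_lt hi))
  exact Real.rpow_le_rpow h0 h1 hq.le

lemma VariationLE.const_mul {k : ℝ} (hk : 0 ≤ k) (hc : 0 ≤ c)
    (hf : ∀ s t, a ≤ s → s ≤ t → t ≤ b → 0 ≤ f s t) (h : VariationLE q f a b c) :
    VariationLE q (fun s t => k * f s t) a b (k * c) := by
  intro D
  rw [Real.mul_rpow hk hc]
  refine le_trans (le_of_eq ?_) (mul_le_mul_of_nonneg_left (h D) (by positivity))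
  rw [Finset.mul_sum]
  refine Finset.sum_congr rfl fun i hi => ?_
  have hi := Finset.mem_range.mp hi
  exact Real.mul_rpow hk
    (hf _ _ (D.left_le hi.le) (D.mono i hi) (D.le_right (Nat.succ_le_of_lt hi)))

/-- Minkowski's inequality. -/
lemma VariationLE.add {c' : ℝ} (hq : 1 ≤ q) (hc : 0 ≤ c) (hc' : 0 ≤ c')
    (hf : ∀ s t, a ≤ s → s ≤ t → t ≤ b → 0 ≤ f s t)
    (hg : ∀ s t, a ≤ s → s ≤ t → t ≤ b → 0 ≤ g s t)
    (h : VariationLE q f a b c) (h' : VariationLE q g a b c') :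
    VariationLE q (fun s t => f s t + g s t) a b (c + c') := by
  intro D
  have hq0 : 0 < q := by linarith
  have hmem : ∀ i ∈ Finset.range D.n, a ≤ D.t i ∧ D.t i ≤ D.t (i + 1) ∧ D.t (i + 1) ≤ b := by
    intro i hi
    have hi := Finset.mem_range.mp hi
    exact ⟨D.left_le hi.le, D.mono i hi, D.le_right (Nat.succ_le_of_lt hi)⟩
  have hf' : ∀ i ∈ Finset.range D.n, 0 ≤ f (D.t i) (D.t (i + 1)) := fun i hi =>
    hf _ _ (hmem i hi).1 (hmem i hi).2.1 (hmem i hi).2.2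
  have hg' : ∀ i ∈ Finset.range D.n, 0 ≤ g (D.t i) (D.t (i + 1)) := fun i hi =>
    hg _ _ (hmem i hi).1 (hmem i hi).2.1 (hmem i hi).2.2
  have key := Real.Lp_add_le_of_nonneg (Finset.range D.n) hq hf' hg'
  have root : ∀ {F : ℕ → ℝ} {e : ℝ}, (∀ i ∈ Finset.range D.n, 0 ≤ F i) → 0 ≤ e →
      ∑ i ∈ Finset.range D.n, F i ^ q ≤ e ^ q →
      (∑ i ∈ Finset.range D.n, F i ^ q) ^ (1 / q) ≤ e := by
    intro F e hF he hle
    have := Real.rpow_le_rpow (Finset.sum_nonneg fun i hi => Real.rpow_nonneg (hF i hi) q) hle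
      (by positivity : 0 ≤ 1 / q)
    rwa [← Real.rpow_mul he, mul_one_div_cancel hq0.ne', Real.rpow_one] at this
  have hle := key.trans (add_le_add (root hf' hc (h D)) (root hg' hc' (h' D)))
  have hS : 0 ≤ ∑ i ∈ Finset.range D.n,
      (f (D.t i) (D.t (i + 1)) + g (D.t i) (D.t (i + 1))) ^ q :=
    Finset.sum_nonneg fun i hi => Real.rpow_nonneg (add_nonneg (hf' i hi) (hg' i hi)) q
  have := Real.rpow_le_rpow (by positivity) hle hq0.le
  rwa [← Real.rpow_mul hS, one_div_mul_cancel hq0.ne', Real.rpow_one] at this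

lemma RootControl.le {s t : ℝ} (hq : 0 < q) (h : RootControl q f a b) {s' t' : ℝ} (hs : a ≤ s)
    (hss : s ≤ s') (hst : s' ≤ t') (htt : t' ≤ t) (ht : t ≤ b) : f s' t' ≤ f s t := by
  have h0 := h.nonneg s t hs (by linarith) ht
  have h1 := h.nonneg s' t' (by linarith) hst (by linarith)
  have e1 := h.superadd s s' t hs hss (by linarith) ht
  have e2 := h.superadd s' t' t (by linarith) hst htt ht
  have p1 := Real.rpow_nonneg (h.nonneg s s' hs hss (by linarith)) q
  have p2 := Real.rpow_nonneg (h.nonneg t' t (by linarith) htt ht) q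
  exact (Real.rpow_le_rpow_iff h1 h0 hq).mp (by linarith)

lemma RootControl.variationLE (h : RootControl q f a b) :
    VariationLE q f a b (f a b) := by
  intro D
  have key : ∀ n ≤ D.n, ∑ i ∈ Finset.range n, f (D.t i) (D.t (i + 1)) ^ q ≤ f a (D.t n) ^ q := by
    intro n
    induction n with
    | zero =>
      intro _
      have hab : a ≤ b := D.t_last ▸ D.left_le le_rfl
      simpa using Real.rpow_nonneg (h.nonneg a (D.t 0) le_rfl (D.left_le (by omega))
        (D.le_right (by omega))) q
    | succ n ih =>
      intro hn
      rw [Finset.sum_range_succ]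
      have := h.superadd a (D.t n) (D.t (n + 1)) le_rfl (D.left_le (by omega))
        (D.mono n (by omega)) (D.le_right hn)
      linarith [ih (by omega)]
  simpa [D.t_last] using key D.n le_rfl

lemma rootControl_length (hq : 0 < q) (a b : ℝ) :
    RootControl q (fun s t => (t - s) ^ (1 / q)) a b := by
  have e : ∀ s t : ℝ, s ≤ t → ((t - s) ^ (1 / q)) ^ q = t - s := fun s t hst => by
    rw [← Real.rpow_mul (by linarith), one_div_mul_cancel hq.ne', Real.rpow_one]
  refine ⟨fun s t _ hst _ => Real.rpow_nonneg (by linarith) _, fun s u t _ hsu hut _ => ?_⟩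
  rw [e s u hsu, e u t hut, e s t (by linarith)]
  linarith

lemma RootControl.const_mul {k : ℝ} (hk : 0 ≤ k) (h : RootControl q f a b) :
    RootControl q (fun s t => k * f s t) a b := by
  refine ⟨fun s t hs hst ht => mul_nonneg hk (h.nonneg s t hs hst ht),
    fun s u t hs hsu hut ht => ?_⟩
  rw [Real.mul_rpow hk (h.nonneg s u hs hsu (by linarith)),
    Real.mul_rpow hk (h.nonneg u t (by linarith) hut ht),
    Real.mul_rpow hk (h.nonneg s t hs (by linarith) ht), ← mul_add]
  exact mul_le_mul_of_nonneg_left (h.superadd s u t hs hsu hut ht) (by positivity)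

/-- The roots of a control are stable under raising the exponent. -/
lemma RootControl.of_le {q' : ℝ} (hq : 0 < q) (hqq : q ≤ q') (h : RootControl q f a b) :
    RootControl q' f a b := by
  refine ⟨h.nonneg, fun s u t hs hsu hut ht => ?_⟩
  have e : ∀ z : ℝ, 0 ≤ z → z ^ q' = (z ^ q) ^ (q' / q) := fun z hz => by
    rw [← Real.rpow_mul hz, mul_div_cancel₀ _ hq.ne']
  have h1 := h.nonneg s u hs hsu (by linarith)
  have h2 := h.nonneg u t (by linarith) hut ht
  have h3 := h.nonneg s t hs (by linarith) ht
  rw [e _ h1, e _ h2, e _ h3]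
  exact (Real.add_rpow_le_rpow_add (by positivity) (by positivity)
    ((one_le_div hq).mpr hqq)).trans
    (Real.rpow_le_rpow (by positivity) (h.superadd s u t hs hsu hut ht)
      (div_nonneg (hq.le.trans hqq) hq.le))

lemma RootControl.sq (h : RootControl q f a b) :
    RootControl (q / 2) (fun s t => f s t ^ 2) a b := by
  have e : ∀ z : ℝ, 0 ≤ z → (z ^ 2) ^ (q / 2) = z ^ q := fun z hz => by
    rw [← Real.rpow_natCast, ← Real.rpow_mul hz]
    congr 1
    push_cast
    ring
  refine ⟨fun s t _ _ _ => sq_nonneg _, fun s u t hs hsu hut ht => ?_⟩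
  rw [e _ (h.nonneg s u hs hsu (by linarith)), e _ (h.nonneg u t (by linarith) hut ht),
    e _ (h.nonneg s t hs (by linarith) ht)]
  exact h.superadd s u t hs hsu hut ht

/-- Hölder's inequality for two terms. -/
lemma rpow_mul_rpow_add_le {x₁ x₂ y₁ y₂ α β : ℝ} (hx₁ : 0 ≤ x₁) (hx₂ : 0 ≤ x₂) (hy₁ : 0 ≤ y₁)
    (hy₂ : 0 ≤ y₂) (hα : 0 < α) (hβ : 0 < β) (hαβ : α + β = 1) :
    x₁ ^ α * y₁ ^ β + x₂ ^ α * y₂ ^ β ≤ (x₁ + x₂) ^ α * (y₁ + y₂) ^ β := by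
  have hpq : (1 / α).HolderConjugate (1 / β) := by
    rw [Real.holderConjugate_iff]
    refine ⟨?_, by simpa using hαβ⟩
    rw [lt_div_iff₀ hα]
    linarith
  have key := Real.inner_le_Lp_mul_Lq_of_nonneg (Finset.univ : Finset (Fin 2)) hpq
    (f := ![x₁ ^ α, x₂ ^ α]) (g := ![y₁ ^ β, y₂ ^ β])
    (by intro i _; fin_cases i <;> simp <;> positivity)
    (by intro i _; fin_cases i <;> simp <;> positivity)
  have e : ∀ {z γ : ℝ}, 0 ≤ z → 0 < γ → (z ^ γ) ^ (1 / γ) = z := fun hz hγ => by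
    rw [← Real.rpow_mul hz, mul_one_div_cancel hγ.ne', Real.rpow_one]
  simpa only [Fin.sum_univ_two, Matrix.cons_val_zero, Matrix.cons_val_one, e hx₁ hα, e hx₂ hα,
    e hy₁ hβ, e hy₂ hβ, one_div_one_div] using key

lemma RootControl.mul {q₁ q₂ : ℝ} (hq : 0 < q) (hq₁ : 0 < q₁) (hq₂ : 0 < q₂)
    (hqq : q / q₁ + q / q₂ = 1) (hf : RootControl q₁ f a b) (hg : RootControl q₂ g a b) :
    RootControl q (fun s t => f s t * g s t) a b := by
  have e : ∀ {z r : ℝ}, 0 ≤ z → 0 < r → z ^ q = (z ^ r) ^ (q / r) := fun hz hr => by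
    rw [← Real.rpow_mul hz, mul_div_cancel₀ _ hr.ne']
  refine ⟨fun s t hs hst ht => mul_nonneg (hf.nonneg s t hs hst ht) (hg.nonneg s t hs hst ht),
    fun s u t hs hsu hut ht => ?_⟩
  have f1 := hf.nonneg s u hs hsu (by linarith)
  have f2 := hf.nonneg u t (by linarith) hut ht
  have f3 := hf.nonneg s t hs (by linarith) ht
  have g1 := hg.nonneg s u hs hsu (by linarith)
  have g2 := hg.nonneg u t (by linarith) hut ht
  have g3 := hg.nonneg s t hs (by linarith) ht
  rw [Real.mul_rpow f1 g1, Real.mul_rpow f2 g2, Real.mul_rpow f3 g3, e f1 hq₁, e f2 hq₁, e f3 hq₁,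
    e g1 hq₂, e g2 hq₂, e g3 hq₂]
  refine (rpow_mul_rpow_add_le (by positivity) (by positivity) (by positivity) (by positivity)
    (by positivity) (by positivity) hqq).trans ?_
  have := hf.superadd s u t hs hsu hut ht
  have := hg.superadd s u t hs hsu hut ht
  gcongr

end Variation

section QVar

variable {W : Type*} [NormedAddCommGroup W] {q a b c : ℝ} {A : ℝ → ℝ → W}

lemma sum_enorm_rpow_eq (hq : 0 ≤ q) (A : ℝ → ℝ → W) (D : IntervalPartition a b) :
    ∑ i ∈ Finset.range D.n, ‖A (D.t i) (D.t (i + 1))‖ₑ ^ q =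
      ENNReal.ofReal (∑ i ∈ Finset.range D.n, ‖A (D.t i) (D.t (i + 1))‖ ^ q) := by
  rw [ENNReal.ofReal_sum_of_nonneg (fun i _ => by positivity)]
  refine Finset.sum_congr rfl fun i _ => ?_
  rw [← ofReal_norm, ENNReal.ofReal_rpow_of_nonneg (norm_nonneg _) hq]

lemma qVar_rpow (hq : 0 < q) (A : ℝ → ℝ → W) (a b : ℝ) :
    qVar q A a b ^ q =
      ⨆ D : IntervalPartition a b, ∑ i ∈ Finset.range D.n, ‖A (D.t i) (D.t (i + 1))‖ₑ ^ q := by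
  rw [qVar, ← ENNReal.rpow_mul, one_div_mul_cancel hq.ne', ENNReal.rpow_one]

lemma qVar_le_ofReal (hq : 0 < q) (hc : 0 ≤ c)
    (h : VariationLE q (fun s t => ‖A s t‖) a b c) : qVar q A a b ≤ ENNReal.ofReal c := by
  rw [← ENNReal.rpow_le_rpow_iff hq, qVar_rpow hq, ENNReal.ofReal_rpow_of_nonneg hc hq.le]
  refine iSup_le fun D => ?_
  rw [sum_enorm_rpow_eq hq.le]
  exact ENNReal.ofReal_le_ofReal (h D)

lemma qVar_toReal_le (hq : 0 < q) (hc : 0 ≤ c)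
    (h : VariationLE q (fun s t => ‖A s t‖) a b c) : (qVar q A a b).toReal ≤ c :=
  ENNReal.toReal_le_of_le_ofReal hc (qVar_le_ofReal hq hc h)

lemma qVar_rpow_superadd (hq : 0 < q) (A : ℝ → ℝ → W) (hab : a ≤ b) (hbc : b ≤ c) :
    qVar q A a b ^ q + qVar q A b c ^ q ≤ qVar q A a c ^ q := by
  have := IntervalPartition.nonempty hab
  have := IntervalPartition.nonempty hbc
  rw [qVar_rpow hq, qVar_rpow hq, qVar_rpow hq]
  refine ENNReal.iSup_add_iSup_le fun D E => ?_
  rw [← IntervalPartition.sum_concat D E (fun s t => ‖A s t‖ₑ ^ q)]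
  exact le_iSup (fun F : IntervalPartition a c =>
    ∑ i ∈ Finset.range F.n, ‖A (F.t i) (F.t (i + 1))‖ₑ ^ q) (D.concat E)

lemma qVar_mono (hq : 0 < q) {s t : ℝ} (has : a ≤ s) (hst : s ≤ t) (htb : t ≤ b) :
    qVar q A s t ≤ qVar q A a b := by
  rw [← ENNReal.rpow_le_rpow_iff hq]
  calc qVar q A s t ^ q ≤ qVar q A s b ^ q :=
        le_self_add.trans (qVar_rpow_superadd hq A hst htb)
    _ ≤ qVar q A a b ^ q := le_add_self.trans (qVar_rpow_superadd hq A has (hst.trans htb))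

lemma rootControl_qVar (hq : 0 < q) (hA : qVar q A a b < ⊤) :
    RootControl q (fun s t => (qVar q A s t).toReal) a b := by
  refine ⟨fun _ _ _ _ _ => ENNReal.toReal_nonneg, fun s u t hs hsu hut ht => ?_⟩
  have fin : ∀ {s t : ℝ}, a ≤ s → s ≤ t → t ≤ b → qVar q A s t ^ q ≠ ⊤ := fun hs hst ht =>
    ENNReal.rpow_ne_top_of_nonneg hq.le ((qVar_mono hq hs hst ht).trans_lt hA).ne
  simp only [ENNReal.toReal_rpow]
  rw [← ENNReal.toReal_add (fin hs hsu (by linarith)) (fin (by linarith) hut ht)]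
  exact ENNReal.toReal_mono (fin hs (by linarith) ht) (qVar_rpow_superadd hq A hsu hut)

lemma norm_le_qVar (hq : 0 < q) (hA : qVar q A a b < ⊤) {s t : ℝ} (hs : a ≤ s) (hst : s ≤ t)
    (ht : t ≤ b) : ‖A s t‖ ≤ (qVar q A s t).toReal := by
  have hfin : qVar q A s t < ⊤ := (qVar_mono hq hs hst ht).trans_lt hA
  have h : ‖A s t‖ₑ ≤ qVar q A s t := by
    rw [← ENNReal.rpow_le_rpow_iff hq, qVar_rpow hq]
    refine le_trans (le_of_eq ?_) (le_iSup _ (IntervalPartition.uniform hst one_pos))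
    simp [IntervalPartition.uniform]
  simpa using ENNReal.toReal_mono hfin.ne h

end QVar

/-! ### The sewing estimate -/

/-- The constant `2 / (1 - 2 ^ (1 - 1 / q))` of the sewing estimate, the solution of
`c = 2 ^ (1 - 1 / q) * c + 2`. -/
noncomputable def sewingConst (q : ℝ) : ℝ := 2 / (1 - 2 ^ (1 - 1 / q))

lemma two_rpow_lt_one {q : ℝ} (hq : 0 < q) (hq1 : q < 1) : (2 : ℝ) ^ (1 - 1 / q) < 1 := by
  refine Real.rpow_lt_one_of_one_lt_of_neg one_lt_two ?_
  have : 1 < 1 / q := by rwa [lt_div_iff₀ hq, one_mul]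
  linarith

lemma sewingConst_pos {q : ℝ} (hq : 0 < q) (hq1 : q < 1) : 0 < sewingConst q :=
  div_pos two_pos (by linarith [two_rpow_lt_one hq hq1])

/-- Sums of an almost additive two-parameter function `Ξ` over a partition stay close to
`Ξ a b`, uniformly in the partition. The partition is cut at the interval where the control first
exceeds half of its total mass: each of the two remaining parts carries at most half of the mass,
and the three pieces are put together at the price of two defects of additivity. -/
theorem norm_sum_sub_le_of_rootControl {E : Type*} [NormedAddCommGroup E] {Ξ : ℝ → ℝ → E}
    {ρ : ℝ → ℝ → ℝ} {q a b L : ℝ} (hq : 0 < q) (hq1 : q < 1) (hL : 0 ≤ L)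
    (hρ : RootControl q ρ a b) (hdiag : ∀ s, a ≤ s → s ≤ b → Ξ s s = 0)
    (hΞ : ∀ s u t, a ≤ s → s ≤ u → u ≤ t → t ≤ b → ‖Ξ s u + Ξ u t - Ξ s t‖ ≤ L * ρ s t)
    (D : IntervalPartition a b) :
    ‖∑ i ∈ Finset.range D.n, Ξ (D.t i) (D.t (i + 1)) - Ξ a b‖ ≤ L * (sewingConst q * ρ a b) := by
  have hKpos := sewingConst_pos hq hq1
  have hK : 2 * (2 ^ (-(1 / q)) * sewingConst q) + 2 = sewingConst q := by
    have h1 : (1 : ℝ) - 2 ^ (1 - 1 / q) ≠ 0 := by linarith [two_rpow_lt_one hq hq1]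
    have h2 : (2 : ℝ) ^ (1 - 1 / q) = 2 * 2 ^ (-(1 / q)) := by
      rw [sub_eq_add_neg, Real.rpow_add two_pos, Real.rpow_one]
    rw [sewingConst]
    rw [h2] at h1 ⊢
    field_simp
    ring
  have half : ∀ {x y : ℝ}, 0 ≤ x → 0 ≤ y → x ^ q ≤ y ^ q / 2 → x ≤ 2 ^ (-(1 / q)) * y := by
    intro x y hx hy h
    have h2 : ((2 : ℝ) ^ (-(1 / q)) * y) ^ q = y ^ q / 2 := by
      rw [Real.mul_rpow (by positivity) hy, ← Real.rpow_mul two_pos.le, neg_mul,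
        one_div_mul_cancel hq.ne', Real.rpow_neg_one]
      ring
    rw [← h2] at h
    exact (Real.rpow_le_rpow_iff hx (by positivity) hq).mp h
  have key : ∀ N i j, i ≤ j → j ≤ D.n → j - i ≤ N →
      ‖∑ l ∈ Finset.Ico i j, Ξ (D.t l) (D.t (l + 1)) - Ξ (D.t i) (D.t j)‖
        ≤ L * (sewingConst q * ρ (D.t i) (D.t j)) := by
    have hnn : ∀ i j, i ≤ j → j ≤ D.n → 0 ≤ ρ (D.t i) (D.t j) := fun i j hij hj =>
      hρ.nonneg _ _ (D.left_le (hij.trans hj)) (D.le_of_le hij hj) (D.le_right hj)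
    have hsup : ∀ i j k, i ≤ j → j ≤ k → k ≤ D.n →
        ρ (D.t i) (D.t j) ^ q + ρ (D.t j) (D.t k) ^ q ≤ ρ (D.t i) (D.t k) ^ q :=
      fun i j k hij hjk hk => hρ.superadd _ _ _ (D.left_le (hij.trans (hjk.trans hk)))
        (D.le_of_le hij (hjk.trans hk)) (D.le_of_le hjk hk) (D.le_right hk)
    have hdef : ∀ i j k, i ≤ j → j ≤ k → k ≤ D.n →
        ‖Ξ (D.t i) (D.t j) + Ξ (D.t j) (D.t k) - Ξ (D.t i) (D.t k)‖ ≤ L * ρ (D.t i) (D.t k) :=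
      fun i j k hij hjk hk => hΞ _ _ _ (D.left_le (hij.trans (hjk.trans hk)))
        (D.le_of_le hij (hjk.trans hk)) (D.le_of_le hjk hk) (D.le_right hk)
    intro N
    induction N with
    | zero =>
      intro i j hij hj hN
      obtain rfl : i = j := by omega
      rw [hdiag _ (D.left_le hj) (D.le_right hj)]
      simpa using mul_nonneg hL (mul_nonneg hKpos.le (hnn i i le_rfl hj))
    | succ N ih =>
      intro i j hij hj hN
      rcases hij.eq_or_lt with rfl | hlt
      · exact ih i i le_rfl hj (by omega)
      -- The alternative `l + 1 = j` only matters when the control vanishes on the whole interval.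
      have hex : ∃ l, i ≤ l ∧ l < j ∧
          (ρ (D.t i) (D.t j) ^ q / 2 < ρ (D.t i) (D.t (l + 1)) ^ q ∨ l + 1 = j) :=
        ⟨j - 1, by omega, by omega, Or.inr (by omega)⟩
      classical
      obtain ⟨hil, hlj, hor⟩ := Nat.find_spec hex
      have hmin := fun m => Nat.find_min (m := m) hex
      generalize Nat.find hex = l at hil hlj hor hmin
      have hp : ∀ x y, x ≤ y → y ≤ D.n → 0 ≤ ρ (D.t x) (D.t y) ^ q := fun x y hxy hy =>
        Real.rpow_nonneg (hnn x y hxy hy) q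
      have hleft : ρ (D.t i) (D.t l) ^ q ≤ ρ (D.t i) (D.t j) ^ q / 2 := by
        rcases hil.eq_or_lt with rfl | hil'
        · linarith [hsup i i i le_rfl le_rfl (by omega), hp i j hij hj]
        · by_contra hcon
          refine hmin (l - 1) (by omega) ⟨by omega, by omega, Or.inl ?_⟩
          rw [show l - 1 + 1 = l by omega]
          exact not_le.mp hcon
      have hright : ρ (D.t (l + 1)) (D.t j) ^ q ≤ ρ (D.t i) (D.t j) ^ q / 2 := by
        rcases hor with h | h
        · linarith [hsup i (l + 1) j (by omega) (by omega) hj]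
        · rw [h]
          linarith [hsup j j j le_rfl le_rfl hj, hp i j hij hj]
      have r1 := half (hnn i l hil (by omega)) (hnn i j hij hj) hleft
      have r2 := half (hnn (l + 1) j (by omega) hj) (hnn i j hij hj) hright
      have i1 := ih i l hil (by omega) (by omega)
      have i2 := ih (l + 1) j (by omega) hj (by omega)
      have d1 := hdef i l (l + 1) hil (by omega) (by omega)
      have d2 := hdef i (l + 1) j (by omega) (by omega) hj
      have r3 : ρ (D.t i) (D.t (l + 1)) ≤ ρ (D.t i) (D.t j) :=
        hρ.le hq (D.left_le (by omega)) le_rfl (D.le_of_le (by omega) (by omega))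
          (D.le_of_le (by omega) hj) (D.le_right hj)
      have hsum : ∑ x ∈ Finset.Ico i j, Ξ (D.t x) (D.t (x + 1)) =
          ∑ x ∈ Finset.Ico i l, Ξ (D.t x) (D.t (x + 1)) + Ξ (D.t l) (D.t (l + 1)) +
            ∑ x ∈ Finset.Ico (l + 1) j, Ξ (D.t x) (D.t (x + 1)) := by
        rw [← Finset.sum_Ico_consecutive _ (show i ≤ l + 1 by omega) (show l + 1 ≤ j by omega),
          Finset.sum_Ico_succ_top hil]
      have hsplit : ∑ x ∈ Finset.Ico i j, Ξ (D.t x) (D.t (x + 1)) - Ξ (D.t i) (D.t j) =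
          (∑ x ∈ Finset.Ico i l, Ξ (D.t x) (D.t (x + 1)) - Ξ (D.t i) (D.t l)) +
          (∑ x ∈ Finset.Ico (l + 1) j, Ξ (D.t x) (D.t (x + 1)) - Ξ (D.t (l + 1)) (D.t j)) +
          (Ξ (D.t i) (D.t l) + Ξ (D.t l) (D.t (l + 1)) - Ξ (D.t i) (D.t (l + 1))) +
          (Ξ (D.t i) (D.t (l + 1)) + Ξ (D.t (l + 1)) (D.t j) - Ξ (D.t i) (D.t j)) := by
        rw [hsum]
        abel
      rw [hsplit]
      have m1 := mul_le_mul_of_nonneg_left (mul_le_mul_of_nonneg_left r1 hKpos.le) hL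
      have m2 := mul_le_mul_of_nonneg_left (mul_le_mul_of_nonneg_left r2 hKpos.le) hL
      have m3 := mul_le_mul_of_nonneg_left r3 hL
      have hfin : L * (sewingConst q * ρ (D.t i) (D.t j)) =
          2 * (L * (sewingConst q * (2 ^ (-(1 / q)) * ρ (D.t i) (D.t j)))) +
            2 * (L * ρ (D.t i) (D.t j)) := by
        nth_rw 1 [← hK]
        ring
      rw [hfin]
      refine norm_add₄_le.trans ?_
      linarith
  simpa [D.t_zero, D.t_last] using key D.n 0 D.n (Nat.zero_le _) le_rfl (by omega)

/-! ### Rough integrals -/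

section Rough

variable {d : ℕ} {W : Type*} [NormedAddCommGroup W] [NormedSpace ℝ W] {p T : ℝ}
  {ζ : ℝ → RSpace d} {ζ2 : ℝ → ℝ → RTensor d}

lemma applyTensor_add (A : RSpace d →L[ℝ] (RSpace d →L[ℝ] W)) (S S' : RTensor d) :
    applyTensor A (S + S') = applyTensor A S + applyTensor A S' := by
  simp [applyTensor, add_smul, Finset.sum_add_distrib]

lemma applyTensor_sub_left (A B : RSpace d →L[ℝ] (RSpace d →L[ℝ] W)) (S : RTensor d) :
    applyTensor (A - B) S = applyTensor A S - applyTensor B S := by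
  simp [applyTensor, smul_sub]

lemma applyTensor_outerProd (A : RSpace d →L[ℝ] (RSpace d →L[ℝ] W)) (u v : RSpace d) :
    applyTensor A (outerProd u v) = A u v := by
  have e : ∀ w : RSpace d, w = ∑ i, w i • EuclideanSpace.single i (1 : ℝ) := fun w => by
    ext j
    simp [Finset.sum_apply, Pi.single_apply]
  conv_rhs => rw [e u, e v]
  simp only [applyTensor, outerProd, map_sum, map_smul, _root_.sum_apply,
    _root_.smul_apply, Finset.smul_sum, smul_smul]
  rw [Finset.sum_comm]
  refine Finset.sum_congr rfl fun i _ => Finset.sum_congr rfl fun j _ => ?_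
  rw [mul_comm]

lemma norm_applyTensor_le (A : RSpace d →L[ℝ] (RSpace d →L[ℝ] W)) (S : RTensor d) :
    ‖applyTensor A S‖ ≤ d ^ 2 * (‖A‖ * ‖S‖) := by
  have h : ∀ i j : Fin d, ‖S (i, j) • A (EuclideanSpace.single i (1 : ℝ))
      (EuclideanSpace.single j (1 : ℝ))‖ ≤ ‖A‖ * ‖S‖ := by
    intro i j
    have h1 : ‖A (EuclideanSpace.single i (1 : ℝ)) (EuclideanSpace.single j (1 : ℝ))‖ ≤ ‖A‖ := by
      simpa using A.le_opNorm₂ (EuclideanSpace.single i (1 : ℝ)) (EuclideanSpace.single j (1 : ℝ))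
    rw [norm_smul, mul_comm]
    gcongr
    exact PiLp.norm_apply_le S (i, j)
  refine (norm_sum_le_of_le _ fun i _ => norm_sum_le_of_le _ fun j _ => h i j).trans ?_
  simp only [Finset.sum_const, Finset.card_univ, Fintype.card_fin, nsmul_eq_mul]
  apply le_of_eq
  ring

lemma IsRoughPath.diag (h : IsRoughPath p T ζ ζ2) {s : ℝ} (h0 : 0 ≤ s) (hs : s ≤ T) :
    ζ2 s s = 0 := by
  have := h.chen s s s h0 le_rfl le_rfl hs
  have e : outerProd (pathIncr ζ s s) (pathIncr ζ s s) = 0 := by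
    ext ij
    simp [outerProd, pathIncr]
  rw [e, add_zero] at this
  simpa using this

lemma norm_le_of_holderSeminorm_le {V : Type*} [NormedAddCommGroup V] {A : ℝ → ℝ → V} {α : ℝ}
    {M : ℝ≥0} (h : holderSeminorm α A T ≤ M) {s t : ℝ} (hs : 0 ≤ s) (hst : s < t)
    (ht : t ≤ T) : ‖A s t‖ ≤ M * (t - s) ^ α := by
  have hts : 0 < t - s := by linarith
  have h1 : ‖A s t‖ₑ / (ENNReal.ofReal (t - s)) ^ α ≤ M := by
    refine le_trans ?_ h
    unfold holderSeminorm
    exact le_iSup_of_le s (le_iSup_of_le t (le_iSup_of_le hs (le_iSup_of_le hst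
      (le_iSup_of_le ht le_rfl))))
  rw [ENNReal.ofReal_rpow_of_pos hts] at h1
  have hpos : 0 < (t - s) ^ α := Real.rpow_pos_of_pos hts α
  rw [ENNReal.div_le_iff (by simpa using hpos) ENNReal.ofReal_ne_top] at h1
  have h2 := ENNReal.toReal_mono (ENNReal.mul_ne_top ENNReal.coe_ne_top ENNReal.ofReal_ne_top) h1
  simpa [ENNReal.toReal_mul, ENNReal.toReal_ofReal hpos.le] using h2

lemma norm_pathIncr_le_of_roughHolderNorm {M : ℝ≥0}
    (hM : roughHolderNorm p T ζ ζ2 ≤ M) {s t : ℝ} (hs : 0 ≤ s) (hst : s ≤ t) (ht : t ≤ T) :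
    ‖pathIncr ζ s t‖ ≤ M * (t - s) ^ (1 / p) := by
  rcases hst.eq_or_lt with rfl | hlt
  · simp [pathIncr]
    positivity
  · exact norm_le_of_holderSeminorm_le (le_self_add.trans hM) hs hlt ht

lemma norm_second_le_of_roughHolderNorm {M : ℝ≥0} (hζ : IsRoughPath p T ζ ζ2)
    (hM : roughHolderNorm p T ζ ζ2 ≤ M) {s t : ℝ} (hs : 0 ≤ s) (hst : s ≤ t) (ht : t ≤ T) :
    ‖ζ2 s t‖ ≤ M * (t - s) ^ (2 / p) := by
  rcases hst.eq_or_lt with rfl | hlt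
  · rw [hζ.diag hs ht]
    simp
    positivity
  · exact norm_le_of_holderSeminorm_le (le_add_self.trans hM) hs hlt ht

/-- The local expansion `Y_s ζ_{s,t} + Y'_s ζ⁽²⁾_{s,t}` of a rough integral. -/
noncomputable def roughGerm (ζ : ℝ → RSpace d) (ζ2 : ℝ → ℝ → RTensor d)
    (Y : ℝ → (RSpace d →L[ℝ] W)) (Y' : ℝ → (RSpace d →L[ℝ] (RSpace d →L[ℝ] W))) (s t : ℝ) : W :=
  Y s (pathIncr ζ s t) + applyTensor (Y' s) (ζ2 s t)

/-- By Chen's relation, the defect of additivity of the local expansion is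
`R^Y_{s,u} ζ_{u,t} + Y'_{s,u} ζ⁽²⁾_{u,t}`. -/
lemma roughGerm_defect (hζ : IsRoughPath p T ζ ζ2) (Y : ℝ → (RSpace d →L[ℝ] W))
    (Y' : ℝ → (RSpace d →L[ℝ] (RSpace d →L[ℝ] W))) {s u t : ℝ} (hs : 0 ≤ s) (hsu : s ≤ u)
    (hut : u ≤ t) (ht : t ≤ T) :
    roughGerm ζ ζ2 Y Y' s u + roughGerm ζ ζ2 Y Y' u t - roughGerm ζ ζ2 Y Y' s t =
      pathRemainder ζ Y Y' s u (pathIncr ζ u t) + applyTensor (pathIncr Y' s u) (ζ2 u t) := by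
  have e : pathIncr ζ s t = pathIncr ζ s u + pathIncr ζ u t := by simp [pathIncr]
  rw [roughGerm, roughGerm, roughGerm, hζ.chen s u t hs hsu hut ht, applyTensor_add,
    applyTensor_add, applyTensor_outerProd, e, map_add]
  simp only [pathRemainder, _root_.sub_apply]
  rw [show pathIncr Y s u = Y u - Y s from rfl, show pathIncr Y' s u = Y' u - Y' s from rfl,
    applyTensor_sub_left, _root_.sub_apply]
  abel

/-- Compensated Riemann sums differ from the local expansion by a multiple of
`‖R^Y‖_{p/2} (t - s)^{1/p} + ‖Y'‖_p (t - s)^{2/p}`. -/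
lemma norm_roughSum_sub_roughGerm_le (hp : 2 ≤ p) (hp3 : p < 3) {M : ℝ≥0}
    (hζ : IsRoughPath p T ζ ζ2) (hM : roughHolderNorm p T ζ ζ2 ≤ M)
    {Y : ℝ → (RSpace d →L[ℝ] W)} {Y' : ℝ → (RSpace d →L[ℝ] (RSpace d →L[ℝ] W))} {s t : ℝ}
    (hs : 0 ≤ s) (hst : s ≤ t) (ht : t ≤ T) (hY' : qVar p (pathIncr Y') s t < ⊤)
    (hR : qVar (p / 2) (pathRemainder ζ Y Y') s t < ⊤) (D : IntervalPartition s t) :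
    ‖roughSum ζ ζ2 Y Y' D - roughGerm ζ ζ2 Y Y' s t‖ ≤
      M * (1 + d ^ 2) * sewingConst (p / 3) * 4 *
        ((qVar (p / 2) (pathRemainder ζ Y Y') s t).toReal * (t - s) ^ (1 / p) +
          (qVar p (pathIncr Y') s t).toReal * (t - s) ^ (2 / p)) := by
  have hp0 : 0 < p := by linarith
  set f : ℝ → ℝ → ℝ := fun s t =>
    (qVar (p / 2) (pathRemainder ζ Y Y') s t).toReal * (t - s) ^ (1 / p) with hf
  set g : ℝ → ℝ → ℝ := fun s t => (qVar p (pathIncr Y') s t).toReal * (t - s) ^ (2 / p) with hg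
  have hcf : RootControl (p / 3) f s t :=
    (rootControl_qVar (by positivity) hR).mul (by positivity) (by positivity) hp0
      (by field_simp; norm_num) (rootControl_length hp0 s t)
  have hlen : RootControl (p / 2) (fun s t : ℝ => (t - s) ^ (2 / p)) s t := by
    simpa using rootControl_length (show 0 < p / 2 by positivity) s t
  have hcg : RootControl (p / 3) g s t :=
    (rootControl_qVar hp0 hY').mul (by positivity) hp0 (by positivity)
      (by field_simp; norm_num) hlen
  -- The sum of two `p/3`-th roots of controls is not such a root, since `p / 3 < 1`; the controls
  -- themselves have to be added.
  set ρ : ℝ → ℝ → ℝ := fun s t => (f s t ^ (p / 3) + g s t ^ (p / 3)) ^ (3 / p) with hρ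
  have hpow : ∀ {x : ℝ}, 0 ≤ x → (x ^ (3 / p)) ^ (p / 3) = x := fun hx => by
    rw [← Real.rpow_mul hx, show 3 / p * (p / 3) = 1 by field_simp, Real.rpow_one]
  have hpow' : ∀ {x : ℝ}, 0 ≤ x → (x ^ (p / 3)) ^ (3 / p) = x := fun hx => by
    rw [← Real.rpow_mul hx, show p / 3 * (3 / p) = 1 by field_simp, Real.rpow_one]
  have h3p : 1 ≤ 3 / p := (one_le_div hp0).mpr hp3.le
  have hcρ : RootControl (p / 3) ρ s t := by
    have nn : ∀ a b, s ≤ a → a ≤ b → b ≤ t → 0 ≤ f a b ^ (p / 3) + g a b ^ (p / 3) :=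
      fun a b ha hab hb => add_nonneg (Real.rpow_nonneg (hcf.nonneg a b ha hab hb) _)
        (Real.rpow_nonneg (hcg.nonneg a b ha hab hb) _)
    refine ⟨fun a b ha hab hb => Real.rpow_nonneg (nn a b ha hab hb) _,
      fun a u b ha hau hub hb => ?_⟩
    simp only [hρ]
    rw [hpow (nn a u ha hau (by linarith)), hpow (nn u b (by linarith) hub hb),
      hpow (nn a b ha (by linarith) hb)]
    linarith [hcf.superadd a u b ha hau hub hb, hcg.superadd a u b ha hau hub hb]
  have hfgρ : ∀ a b, s ≤ a → a ≤ b → b ≤ t → f a b + g a b ≤ ρ a b := by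
    intro a b ha hab hb
    have f0 := hcf.nonneg a b ha hab hb
    have g0 := hcg.nonneg a b ha hab hb
    have := Real.add_rpow_le_rpow_add (Real.rpow_nonneg f0 (p / 3)) (Real.rpow_nonneg g0 (p / 3))
      h3p
    rwa [hpow' f0, hpow' g0] at this
  have hρfg : ρ s t ≤ 4 * (f s t + g s t) := by
    have f0 := hcf.nonneg s t le_rfl hst le_rfl
    have g0 := hcg.nonneg s t le_rfl hst le_rfl
    have h1 : f s t ^ (p / 3) + g s t ^ (p / 3) ≤ 2 * (f s t + g s t) ^ (p / 3) := by
      have a1 : f s t ^ (p / 3) ≤ (f s t + g s t) ^ (p / 3) :=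
        Real.rpow_le_rpow f0 (by linarith) (by positivity)
      have a2 : g s t ^ (p / 3) ≤ (f s t + g s t) ^ (p / 3) :=
        Real.rpow_le_rpow g0 (by linarith) (by positivity)
      linarith
    have h2 : (2 : ℝ) ^ (3 / p) ≤ 4 := by
      calc (2 : ℝ) ^ (3 / p) ≤ 2 ^ (2 : ℝ) := by
            refine Real.rpow_le_rpow_of_exponent_le one_le_two ?_
            rw [div_le_iff₀ hp0]
            linarith
        _ = 4 := by norm_num
    calc ρ s t ≤ (2 * (f s t + g s t) ^ (p / 3)) ^ (3 / p) :=
          Real.rpow_le_rpow (by positivity) h1 (by positivity)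
      _ = 2 ^ (3 / p) * (f s t + g s t) := by
          rw [Real.mul_rpow two_pos.le (by positivity), hpow' (by positivity)]
      _ ≤ 4 * (f s t + g s t) := by gcongr
  have hL : (0 : ℝ) ≤ M * (1 + d ^ 2) := by positivity
  have key := norm_sum_sub_le_of_rootControl (Ξ := roughGerm ζ ζ2 Y Y') (by positivity)
    (by linarith) hL hcρ (fun u hu hut => ?_) (fun a u b ha hau hub hb => ?_) D
  · refine key.trans ?_
    have := sewingConst_pos (show 0 < p / 3 by positivity) (by linarith)
    calc M * (1 + d ^ 2) * (sewingConst (p / 3) * ρ s t)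
        ≤ M * (1 + d ^ 2) * (sewingConst (p / 3) * (4 * (f s t + g s t))) := by gcongr
      _ = _ := by simp only [hf, hg]; ring
  · rw [roughGerm, hζ.diag (by linarith) (by linarith)]
    simp [pathIncr, applyTensor]
  · rw [roughGerm_defect hζ Y Y' (by linarith) hau hub (by linarith)]
    have cR := (rootControl_qVar (by positivity) hR).le (by positivity) ha le_rfl hau hub hb
    have cY := (rootControl_qVar hp0 hY').le hp0 ha le_rfl hau hub hb
    have n1 := norm_le_qVar (by positivity) hR ha hau (by linarith)
    have n2 := norm_le_qVar hp0 hY' ha hau (by linarith)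
    have z1 := norm_pathIncr_le_of_roughHolderNorm hM (s := u) (t := b) (by linarith) hub
      (by linarith)
    have z2 := norm_second_le_of_roughHolderNorm hζ hM (s := u) (t := b) (by linarith) hub
      (by linarith)
    have w1 : (b - u) ^ (1 / p) ≤ (b - a) ^ (1 / p) :=
      Real.rpow_le_rpow (by linarith) (by linarith) (by positivity)
    have w2 : (b - u) ^ (2 / p) ≤ (b - a) ^ (2 / p) :=
      Real.rpow_le_rpow (by linarith) (by linarith) (by positivity)
    have hb1 : 0 ≤ (b - a) ^ (1 / p) := Real.rpow_nonneg (by linarith) _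
    have hb2 : 0 ≤ (b - a) ^ (2 / p) := Real.rpow_nonneg (by linarith) _
    have b1 : ‖pathRemainder ζ Y Y' a u (pathIncr ζ u b)‖ ≤ M * f a b := by
      refine (ContinuousLinearMap.le_opNorm _ _).trans ?_
      calc _ ≤ (qVar (p / 2) (pathRemainder ζ Y Y') a b).toReal * (M * (b - a) ^ (1 / p)) :=
            mul_le_mul (n1.trans cR) (z1.trans (by gcongr)) (norm_nonneg _)
              ENNReal.toReal_nonneg
        _ = _ := by simp only [hf]; ring
    have b2 : ‖applyTensor (pathIncr Y' a u) (ζ2 u b)‖ ≤ M * (d ^ 2 * g a b) := by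
      refine (norm_applyTensor_le _ _).trans ?_
      calc _ ≤ (d : ℝ) ^ 2 * ((qVar p (pathIncr Y') a b).toReal * (M * (b - a) ^ (2 / p))) := by
            refine mul_le_mul_of_nonneg_left ?_ (by positivity)
            exact mul_le_mul (n2.trans cY) (z2.trans (by gcongr)) (norm_nonneg _)
              ENNReal.toReal_nonneg
        _ = _ := by simp only [hg]; ring
    have f0 := hcf.nonneg a b ha (by linarith) hb
    have g0 := hcg.nonneg a b ha (by linarith) hb
    calc _ ≤ M * f a b + M * (d ^ 2 * g a b) := (norm_add_le _ _).trans (add_le_add b1 b2)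
      _ ≤ M * (1 + d ^ 2) * (f a b + g a b) := by
          have : 0 ≤ (M : ℝ) * (d ^ 2 * f a b + g a b) := by positivity
          linarith
      _ ≤ _ := mul_le_mul_of_nonneg_left (hfgρ a b ha (by linarith) hb) hL

/-- Rough integrals are additive in the interval, so that the sewing estimate bounds the increments
of an indefinite rough integral. -/
lemma norm_roughIntegral_sub_roughGerm_le {Y : ℝ → (RSpace d →L[ℝ] W)}
    {Y' : ℝ → (RSpace d →L[ℝ] (RSpace d →L[ℝ] W))} {s t B : ℝ} {I J : W} (hs : 0 ≤ s)
    (hst : s ≤ t) (hI : IsRoughIntegral ζ ζ2 Y Y' 0 s I) (hJ : IsRoughIntegral ζ ζ2 Y Y' 0 t J)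
    (hB : ∀ D : IntervalPartition s t, ‖roughSum ζ ζ2 Y Y' D - roughGerm ζ ζ2 Y Y' s t‖ ≤ B) :
    ‖J - I - roughGerm ζ ζ2 Y Y' s t‖ ≤ B := by
  refine le_of_forall_pos_le_add fun ε hε => ?_
  obtain ⟨δ₁, hδ₁, h1⟩ := hI (ε / 2) (by positivity)
  obtain ⟨δ₂, hδ₂, h2⟩ := hJ (ε / 2) (by positivity)
  obtain ⟨D, hD⟩ := IntervalPartition.exists_mesh_lt hs (lt_min hδ₁ hδ₂)
  obtain ⟨E, hE⟩ := IntervalPartition.exists_mesh_lt hst (lt_min hδ₁ hδ₂)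
  have e1 := h1 D fun i hi => (hD i hi).trans_le (min_le_left _ _)
  have e2 := h2 (D.concat E) fun i hi =>
    (D.concat_mesh_lt E hD hE i hi).trans_le (min_le_right _ _)
  have hsum : roughSum ζ ζ2 Y Y' (D.concat E) = roughSum ζ ζ2 Y Y' D + roughSum ζ ζ2 Y Y' E :=
    D.sum_concat E (roughGerm ζ ζ2 Y Y')
  have hdec : J - I - roughGerm ζ ζ2 Y Y' s t =
      (roughSum ζ ζ2 Y Y' E - roughGerm ζ ζ2 Y Y' s t) + (roughSum ζ ζ2 Y Y' D - I) -
        (roughSum ζ ζ2 Y Y' (D.concat E) - J) := by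
    rw [hsum]
    abel
  rw [hdec]
  have n1 := norm_sub_le ((roughSum ζ ζ2 Y Y' E - roughGerm ζ ζ2 Y Y' s t) +
    (roughSum ζ ζ2 Y Y' D - I)) (roughSum ζ ζ2 Y Y' (D.concat E) - J)
  have n2 := norm_add_le (roughSum ζ ζ2 Y Y' E - roughGerm ζ ζ2 Y Y' s t)
    (roughSum ζ ζ2 Y Y' D - I)
  linarith [hB E]

end Rough

/-! ### Compositions with functions of class `C²_b` -/

section C2

variable {V W : Type*} [NormedAddCommGroup V] [NormedSpace ℝ V] [NormedAddCommGroup W]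
  [NormedSpace ℝ W] {K : ℝ≥0} {f : V → W}

lemma IsC2Bounded.norm_le (h : IsC2Bounded K f) (z : V) : ‖f z‖ ≤ K := by
  simpa using h.2 0 (by norm_num) z

lemma IsC2Bounded.differentiable (h : IsC2Bounded K f) : Differentiable ℝ f :=
  h.1.differentiable (by norm_num)

lemma IsC2Bounded.norm_fderiv_le (h : IsC2Bounded K f) (z : V) : ‖fderiv ℝ f z‖ ≤ K := by
  simpa [norm_iteratedFDeriv_one] using h.2 1 (by norm_num) z

lemma IsC2Bounded.norm_sub_le (h : IsC2Bounded K f) (z z' : V) : ‖f z' - f z‖ ≤ K * ‖z' - z‖ :=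
  convex_univ.norm_image_sub_le_of_norm_fderiv_le (fun x _ => h.differentiable x)
    (fun x _ => h.norm_fderiv_le x) (Set.mem_univ z) (Set.mem_univ z')

lemma IsC2Bounded.norm_fderiv_sub_le (h : IsC2Bounded K f) (z z' : V) :
    ‖fderiv ℝ f z' - fderiv ℝ f z‖ ≤ K * ‖z' - z‖ := by
  have hd : Differentiable ℝ (fderiv ℝ f) :=
    (h.1.fderiv_right (m := 1) (by norm_num)).differentiable (by norm_num)
  refine convex_univ.norm_image_sub_le_of_norm_fderiv_le (fun x _ => hd x)
    (fun x _ => ?_) (Set.mem_univ z) (Set.mem_univ z')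
  have := h.2 2 le_rfl x
  rwa [← norm_iteratedFDeriv_fderiv, norm_iteratedFDeriv_one] at this

lemma IsC2Bounded.norm_taylor_le (h : IsC2Bounded K f) (z z' : V) :
    ‖f z' - f z - fderiv ℝ f z (z' - z)‖ ≤ K * ‖z' - z‖ ^ 2 := by
  have := (convex_closedBall z ‖z' - z‖).norm_image_sub_le_of_norm_fderiv_le'
    (𝕜 := ℝ) (f := f) (φ := fderiv ℝ f z) (C := K * ‖z' - z‖)
    (fun x _ => h.differentiable x)
    (fun x hx => (h.norm_fderiv_sub_le z x).trans
      (mul_le_mul_of_nonneg_left (by simpa [dist_eq_norm] using hx) K.2))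
    (Metric.mem_closedBall_self (norm_nonneg _)) (by simp [dist_eq_norm] : z' ∈ _)
  refine this.trans (le_of_eq ?_)
  ring

end C2

section Composition

variable {m d k : ℕ} {W : Type*} [NormedAddCommGroup W] [NormedSpace ℝ W] {K : ℝ≥0}
  {φ : RSpace m × RSpace k → W} {σ : RSpace m × RSpace k → (RSpace d →L[ℝ] RSpace m)}
  {X : ℝ → RSpace m} {γ : ℝ → RSpace k} {ζ : ℝ → RSpace d} {p u v : ℝ}

lemma IsC2Bounded.fderiv_partial (h : IsC2Bounded K φ) (x : RSpace m) (g : RSpace k) :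
    fderiv ℝ (fun x : RSpace m => φ (x, g)) x =
      (fderiv ℝ φ (x, g)).comp (ContinuousLinearMap.inl ℝ (RSpace m) (RSpace k)) :=
  ((h.differentiable (x, g)).hasFDerivAt.comp x (hasFDerivAt_prodMk_left x g)).fderiv

lemma norm_comp_inl_le (L : RSpace m × RSpace k →L[ℝ] W) :
    ‖L.comp (ContinuousLinearMap.inl ℝ (RSpace m) (RSpace k))‖ ≤ ‖L‖ := by
  refine (ContinuousLinearMap.opNorm_comp_le _ _).trans ?_
  exact mul_le_of_le_one_right (norm_nonneg _) (ContinuousLinearMap.norm_inl_le_one _ _ _)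

lemma norm_pair_sub_le (x x' : RSpace m) (g g' : RSpace k) :
    ‖(x', g') - (x, g)‖ ≤ ‖x' - x‖ + ‖g' - g‖ := by
  rw [Prod.mk_sub_mk, Prod.norm_mk]
  exact max_le (le_add_of_nonneg_right (norm_nonneg _)) (le_add_of_nonneg_left (norm_nonneg _))

lemma norm_compDeriv_le (hφ : IsC2Bounded K φ) (hσ : IsC2Bounded K σ) (t : ℝ) :
    ‖compDeriv φ X (compPath σ X γ) γ t‖ ≤ K * K := by
  rw [compDeriv, hφ.fderiv_partial]
  refine (ContinuousLinearMap.opNorm_comp_le _ _).trans ?_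
  exact mul_le_mul ((norm_comp_inl_le _).trans (hφ.norm_fderiv_le _)) (hσ.norm_le _)
    (norm_nonneg _) K.2

lemma norm_pathIncr_compDeriv_le (hφ : IsC2Bounded K φ) (hσ : IsC2Bounded K σ) (s t : ℝ) :
    ‖pathIncr (compDeriv φ X (compPath σ X γ) γ) s t‖ ≤
      2 * K ^ 2 * (‖pathIncr X s t‖ + ‖pathIncr γ s t‖) := by
  rw [pathIncr, compDeriv, compDeriv, hφ.fderiv_partial, hφ.fderiv_partial]
  set A : ℝ → (RSpace m →L[ℝ] W) := fun t =>
    (fderiv ℝ φ (X t, γ t)).comp (ContinuousLinearMap.inl ℝ (RSpace m) (RSpace k)) with hA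
  set B : ℝ → (RSpace d →L[ℝ] RSpace m) := compPath σ X γ with hB
  change ‖(A t).comp (B t) - (A s).comp (B s)‖ ≤ _
  have e : (A t).comp (B t) - (A s).comp (B s) =
      (A t - A s).comp (B t) + (A s).comp (B t - B s) := by
    ext x
    simp
  have hz := norm_pair_sub_le (X s) (X t) (γ s) (γ t)
  have a1 : ‖A t - A s‖ ≤ K * (‖pathIncr X s t‖ + ‖pathIncr γ s t‖) := by
    have : A t - A s = (fderiv ℝ φ (X t, γ t) - fderiv ℝ φ (X s, γ s)).comp
        (ContinuousLinearMap.inl ℝ (RSpace m) (RSpace k)) := by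
      ext x
      simp [hA]
    rw [this]
    exact (norm_comp_inl_le _).trans ((hφ.norm_fderiv_sub_le _ _).trans
      (mul_le_mul_of_nonneg_left hz K.2))
  have a2 : ‖A s‖ ≤ K := (norm_comp_inl_le _).trans (hφ.norm_fderiv_le _)
  have b1 : ‖B t - B s‖ ≤ K * (‖pathIncr X s t‖ + ‖pathIncr γ s t‖) :=
    (hσ.norm_sub_le _ _).trans (mul_le_mul_of_nonneg_left hz K.2)
  have b2 : ‖B t‖ ≤ K := hσ.norm_le _
  rw [e]
  calc _ ≤ ‖A t - A s‖ * ‖B t‖ + ‖A s‖ * ‖B t - B s‖ :=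
        (norm_add_le _ _).trans (add_le_add (ContinuousLinearMap.opNorm_comp_le _ _)
          (ContinuousLinearMap.opNorm_comp_le _ _))
    _ ≤ K * (‖pathIncr X s t‖ + ‖pathIncr γ s t‖) * K +
          K * (K * (‖pathIncr X s t‖ + ‖pathIncr γ s t‖)) := by gcongr
    _ = _ := by ring

/-- A Taylor expansion in the first variable and the Lipschitz bound in the second. -/
lemma norm_pathRemainder_comp_le (hφ : IsC2Bounded K φ) (s t : ℝ) :
    ‖pathRemainder ζ (compPath φ X γ) (compDeriv φ X (compPath σ X γ) γ) s t‖ ≤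
      K * (‖pathIncr X s t‖ ^ 2 + ‖pathRemainder ζ X (compPath σ X γ) s t‖ +
        ‖pathIncr γ s t‖) := by
  set L := fderiv ℝ φ (X s, γ s) with hL
  set R := pathRemainder ζ X (compPath σ X γ) s t with hR
  have e : pathRemainder ζ (compPath φ X γ) (compDeriv φ X (compPath σ X γ) γ) s t =
      (φ (X t, γ s) - φ (X s, γ s) - L ((X t, γ s) - (X s, γ s))) + L (R, 0) +
        (φ (X t, γ t) - φ (X t, γ s)) := by
    have h1 : ((X t, γ s) - (X s, γ s) : RSpace m × RSpace k) =
        (R, 0) + ((compPath σ X γ s) (pathIncr ζ s t), 0) := by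
      simp [hR, pathRemainder, pathIncr]
    rw [h1, map_add, pathRemainder, pathIncr, compDeriv, hφ.fderiv_partial]
    simp only [compPath, ContinuousLinearMap.comp_apply, ContinuousLinearMap.inl_apply, ← hL]
    abel
  have hX : ‖((X t, γ s) - (X s, γ s) : RSpace m × RSpace k)‖ = ‖pathIncr X s t‖ := by
    simp [pathIncr, Prod.norm_def]
  have hγ : ‖((X t, γ t) - (X t, γ s) : RSpace m × RSpace k)‖ = ‖pathIncr γ s t‖ := by
    simp [pathIncr, Prod.norm_def]
  have hR0 : ‖((R, 0) : RSpace m × RSpace k)‖ = ‖R‖ := by simp [Prod.norm_def]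
  have n1 := hφ.norm_taylor_le (X s, γ s) (X t, γ s)
  have n2 := hφ.norm_sub_le (X t, γ s) (X t, γ t)
  have n3 : ‖L (R, 0)‖ ≤ K * ‖R‖ := by
    rw [← hR0]
    exact (L.le_opNorm _).trans
      (mul_le_mul_of_nonneg_right (hφ.norm_fderiv_le _) (norm_nonneg _))
  rw [hX] at n1
  rw [hγ] at n2
  rw [e]
  refine norm_add₃_le.trans ?_
  rw [mul_add, mul_add]
  exact add_le_add (add_le_add n1 n3) n2

/-- The variation of `φ(X, γ)'` is controlled by those of `X` and `γ`. -/
lemma qVar_compDeriv_le (hp : 2 ≤ p) (huv : u ≤ v) (hφ : IsC2Bounded K φ) (hσ : IsC2Bounded K σ)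
    (hX : qVar p (pathIncr X) u v < ⊤) (hγ : qVar (p / 2) (pathIncr γ) u v < ⊤) :
    qVar p (pathIncr (compDeriv φ X (compPath σ X γ) γ)) u v ≤
      ENNReal.ofReal (2 * K ^ 2 *
        ((qVar p (pathIncr X) u v).toReal + (qVar (p / 2) (pathIncr γ) u v).toReal)) := by
  have hp0 : 0 < p := by linarith
  have hp2 : 0 < p / 2 := by positivity
  have cX := rootControl_qVar hp0 hX
  have cγ := (rootControl_qVar hp2 hγ).of_le hp2 (q' := p) (by linarith)
  have key := (cX.variationLE.add (by linarith) (cX.nonneg u v le_rfl huv le_rfl)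
    (cγ.nonneg u v le_rfl huv le_rfl) cX.nonneg cγ.nonneg cγ.variationLE).const_mul
    (k := 2 * K ^ 2) (by positivity) (by positivity)
    fun s t hs hst ht => add_nonneg (cX.nonneg s t hs hst ht) (cγ.nonneg s t hs hst ht)
  refine qVar_le_ofReal hp0 (by positivity) (key.mono hp0 fun s t hs hst ht =>
    ⟨norm_nonneg _, (norm_pathIncr_compDeriv_le hφ hσ s t).trans ?_⟩)
  have := norm_le_qVar hp0 hX hs hst ht
  have := norm_le_qVar hp2 hγ hs hst ht
  gcongr

/-- The variation of the remainder of `φ(X, γ)` is controlled by that of `γ`, the square of that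
of `X`, and that of the remainder of `X`. -/
lemma qVar_pathRemainder_comp_le (hp : 2 ≤ p) (huv : u ≤ v) (hφ : IsC2Bounded K φ)
    (hX : qVar p (pathIncr X) u v < ⊤) (hγ : qVar (p / 2) (pathIncr γ) u v < ⊤)
    (hR : qVar (p / 2) (pathRemainder ζ X (compPath σ X γ)) u v < ⊤) :
    qVar (p / 2) (pathRemainder ζ (compPath φ X γ) (compDeriv φ X (compPath σ X γ) γ)) u v ≤
      ENNReal.ofReal (K * ((qVar p (pathIncr X) u v).toReal ^ 2 +
        (qVar (p / 2) (pathRemainder ζ X (compPath σ X γ)) u v).toReal +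
        (qVar (p / 2) (pathIncr γ) u v).toReal)) := by
  have hp0 : 0 < p := by linarith
  have hp2 : 0 < p / 2 := by positivity
  have cX := (rootControl_qVar hp0 hX).sq
  have cγ := rootControl_qVar hp2 hγ
  have cR := rootControl_qVar hp2 hR
  have k1 := cX.variationLE.add (by linarith) (cX.nonneg u v le_rfl huv le_rfl)
    (cR.nonneg u v le_rfl huv le_rfl) cX.nonneg cR.nonneg cR.variationLE
  have n1 := fun s t hs hst ht => add_nonneg (cX.nonneg s t hs hst ht) (cR.nonneg s t hs hst ht)
  have k2 := k1.add (by linarith) (n1 u v le_rfl huv le_rfl)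
    (cγ.nonneg u v le_rfl huv le_rfl) n1 cγ.nonneg cγ.variationLE
  have n2 := fun s t hs hst ht => add_nonneg (n1 s t hs hst ht) (cγ.nonneg s t hs hst ht)
  refine qVar_le_ofReal hp2 (by positivity)
    ((k2.const_mul K.2 (n2 u v le_rfl huv le_rfl) n2).mono hp2 fun s t hs hst ht =>
    ⟨norm_nonneg _, (norm_pathRemainder_comp_le hφ s t).trans ?_⟩)
  have := norm_le_qVar hp0 hX hs hst ht
  have := norm_le_qVar hp2 hγ hs hst ht
  have := norm_le_qVar hp2 hR hs hst ht
  exact mul_le_mul_of_nonneg_left (by gcongr) K.2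

end Composition

/-! ### Local estimates for solutions -/

section Local

variable {m d k : ℕ} {p T : ℝ} {M K : ℝ≥0} {b : RSpace m × RSpace k → RSpace m}
  {σ : RSpace m × RSpace k → (RSpace d →L[ℝ] RSpace m)}
  {ζ : ℝ → RSpace d} {ζ2 : ℝ → ℝ → RTensor d} {γ : ℝ → RSpace k} {x₀ : RSpace m}
  {X : ℝ → RSpace m}

lemma IsLipBounded.norm_integral_sub_le (hb : IsLipBounded K b)
    (hX : ContinuousOn X (Set.Icc 0 T)) (hγ : ContinuousOn γ (Set.Icc 0 T)) {s t : ℝ}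
    (hs : 0 ≤ s) (hst : s ≤ t) (ht : t ≤ T) :
    ‖(∫ r in (0 : ℝ)..t, b (X r, γ r)) - ∫ r in (0 : ℝ)..s, b (X r, γ r)‖ ≤ K * (t - s) := by
  have hc : ContinuousOn (fun r => b (X r, γ r)) (Set.Icc 0 T) :=
    hb.1.continuous.comp_continuousOn (hX.prodMk hγ)
  have hi : ∀ r, 0 ≤ r → r ≤ T →
      IntervalIntegrable (fun r => b (X r, γ r)) MeasureTheory.volume 0 r := fun r h0 hr =>
    (hc.mono (by rw [Set.uIcc_of_le h0]; exact Set.Icc_subset_Icc_right hr)).intervalIntegrable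
  rw [intervalIntegral.integral_interval_sub_left (hi t (by linarith) ht) (hi s hs (by linarith))]
  refine (intervalIntegral.norm_integral_le_of_norm_le_const fun r _ => hb.2 _).trans ?_
  rw [abs_of_nonneg (by linarith)]

/-- The remainder of a solution over `[s, t]`: the drift contributes `t - s`, the second level of
the rough path `(t - s)^{2/p}`, and the rest is the sewing estimate. -/
lemma IsRDESolution.norm_pathRemainder_le (hp : 2 ≤ p) (hp3 : p < 3) (hb : IsLipBounded K b)
    (hσ : IsC2Bounded K σ) (hζ : IsRoughPath p T ζ ζ2) (hM : roughHolderNorm p T ζ ζ2 ≤ M)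
    (hγ : IsQVarPath (p / 2) T γ) (hX : IsRDESolution p T b σ ζ ζ2 γ x₀ X)
    {s t : ℝ} (hs : 0 ≤ s) (hst : s ≤ t) (ht : t ≤ T)
    (hY' : qVar p (pathIncr (compDeriv σ X (compPath σ X γ) γ)) s t < ⊤)
    (hR : qVar (p / 2) (pathRemainder ζ (compPath σ X γ) (compDeriv σ X (compPath σ X γ) γ)) s t
      < ⊤) :
    ‖pathRemainder ζ X (compPath σ X γ) s t‖ ≤
      M * (1 + d ^ 2) * sewingConst (p / 3) * 4 *
        ((qVar (p / 2) (pathRemainder ζ (compPath σ X γ)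
          (compDeriv σ X (compPath σ X γ) γ)) s t).toReal * (t - s) ^ (1 / p) +
          (qVar p (pathIncr (compDeriv σ X (compPath σ X γ) γ)) s t).toReal * (t - s) ^ (2 / p)) +
      (K * T ^ (1 - 2 / p) + d ^ 2 * (K * K * M)) * (t - s) ^ (2 / p) := by
  have hp0 : 0 < p := by linarith
  have hint := norm_roughIntegral_sub_roughGerm_le hs hst (hX.equation s ⟨hs, hst.trans ht⟩)
    (hX.equation t ⟨hs.trans hst, ht⟩) fun D =>
      norm_roughSum_sub_roughGerm_le hp hp3 hζ hM hs hst ht hY' hR D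
  have hdrift := hb.norm_integral_sub_le hX.controlled.path.1 hγ.1 hs hst ht
  have htens : ‖applyTensor (compDeriv σ X (compPath σ X γ) γ s) (ζ2 s t)‖ ≤
      d ^ 2 * (K * K * (M * (t - s) ^ (2 / p))) := by
    refine (norm_applyTensor_le _ _).trans (mul_le_mul_of_nonneg_left ?_ (by positivity))
    exact mul_le_mul (norm_compDeriv_le hσ hσ s)
      (norm_second_le_of_roughHolderNorm hζ hM hs hst ht) (norm_nonneg _) (by positivity)
  have hlen : t - s ≤ T ^ (1 - 2 / p) * (t - s) ^ (2 / p) := by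
    have h0 : 0 ≤ t - s := by linarith
    have h1 : 0 ≤ 1 - 2 / p := by
      rw [sub_nonneg, div_le_one hp0]
      exact hp
    calc t - s = (t - s) ^ (1 - 2 / p) * (t - s) ^ (2 / p) := by
          rw [← Real.rpow_add_of_nonneg h0 h1 (by positivity)]
          simp
      _ ≤ _ := by
          have : (t - s) ^ (1 - 2 / p) ≤ T ^ (1 - 2 / p) :=
            Real.rpow_le_rpow h0 (by linarith) h1
          gcongr
  have hdrift' : (K : ℝ) * (t - s) ≤ K * (T ^ (1 - 2 / p) * (t - s) ^ (2 / p)) := by gcongr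
  set I : ℝ → RSpace m := fun t => ∫ r in (0 : ℝ)..t, b (X r, γ r) with hI
  have e : pathRemainder ζ X (compPath σ X γ) s t =
      (X t - x₀ - I t - (X s - x₀ - I s) -
        roughGerm ζ ζ2 (compPath σ X γ) (compDeriv σ X (compPath σ X γ) γ) s t) + (I t - I s) +
      applyTensor (compDeriv σ X (compPath σ X γ) γ s) (ζ2 s t) := by
    simp only [pathRemainder, roughGerm, pathIncr]
    abel
  rw [e]
  refine norm_add₃_le.trans ((add_le_add_three hint hdrift htens).trans ?_)
  linarith

/-- The constant in the local estimates for solutions. -/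
noncomputable def localConst (p T : ℝ) (M K : ℝ≥0) (d : ℕ) : ℝ :=
  1 + M * K + (K * T ^ (1 - 2 / p) + d ^ 2 * (K * K * M)) +
    M * (1 + d ^ 2) * sewingConst (p / 3) * 4 * (2 * K ^ 2 + K)

lemma norm_pathIncr_sub_pathRemainder_le (hp : 2 ≤ p) (hp3 : p < 3) (hT : 0 < T)
    (hσ : IsC2Bounded K σ) (hM : roughHolderNorm p T ζ ζ2 ≤ M) {s t : ℝ} (hs : 0 ≤ s)
    (hst : s ≤ t) (ht : t ≤ T) :
    ‖pathIncr X s t - pathRemainder ζ X (compPath σ X γ) s t‖ ≤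
      localConst p T M K d * (t - s) ^ (1 / p) := by
  have hS := sewingConst_pos (show 0 < p / 3 by linarith) (by linarith)
  have e : pathIncr X s t - pathRemainder ζ X (compPath σ X γ) s t =
      compPath σ X γ s (pathIncr ζ s t) := by
    simp [pathRemainder]
  have h1 : ‖compPath σ X γ s (pathIncr ζ s t)‖ ≤ K * (M * (t - s) ^ (1 / p)) :=
    (ContinuousLinearMap.le_opNorm _ _).trans
      (mul_le_mul (hσ.norm_le _) (norm_pathIncr_le_of_roughHolderNorm hM hs hst ht)
        (norm_nonneg _) K.2)
  have h0 : 0 ≤ (t - s) ^ (1 / p) := Real.rpow_nonneg (by linarith) _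
  have h2 : (M * K : ℝ) ≤ localConst p T M K d := by
    have : (0 : ℝ) ≤ 1 + (K * T ^ (1 - 2 / p) + d ^ 2 * (K * K * M)) +
      M * (1 + d ^ 2) * sewingConst (p / 3) * 4 * (2 * K ^ 2 + K) := by positivity
    rw [localConst]
    linarith
  rw [e]
  linarith [mul_le_mul_of_nonneg_right h2 h0]

lemma one_le_localConst (hp : 2 ≤ p) (hp3 : p < 3) (hT : 0 < T) (M K : ℝ≥0) (d : ℕ) :
    1 ≤ localConst p T M K d := by
  have hS := sewingConst_pos (show 0 < p / 3 by linarith) (by linarith)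
  have : (0 : ℝ) ≤ M * K + (K * T ^ (1 - 2 / p) + d ^ 2 * (K * K * M)) +
    M * (1 + d ^ 2) * sewingConst (p / 3) * 4 * (2 * K ^ 2 + K) := by positivity
  rw [localConst]
  linarith

/-- The estimate of the remainder in terms of itself. The factor `(t - s)^{1/p}` in front of the
remainder on the right-hand side makes it possible to absorb it on short intervals. -/
lemma IsRDESolution.qVar_pathRemainder_le (hp : 2 ≤ p) (hp3 : p < 3) (hT : 0 < T)
    (hb : IsLipBounded K b) (hσ : IsC2Bounded K σ) (hζ : IsRoughPath p T ζ ζ2)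
    (hM : roughHolderNorm p T ζ ζ2 ≤ M) (hγ : IsQVarPath (p / 2) T γ)
    (hX : IsRDESolution p T b σ ζ ζ2 γ x₀ X) {s t : ℝ} (hs : 0 ≤ s) (hst : s ≤ t) (ht : t ≤ T) :
    (qVar (p / 2) (pathRemainder ζ X (compPath σ X γ)) s t).toReal ≤ localConst p T M K d *
      ((1 + (qVar p (pathIncr X) s t).toReal + (qVar (p / 2) (pathIncr γ) s t).toReal) *
          (t - s) ^ (2 / p) +
        ((qVar p (pathIncr X) s t).toReal ^ 2 +
          (qVar (p / 2) (pathRemainder ζ X (compPath σ X γ)) s t).toReal +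
          (qVar (p / 2) (pathIncr γ) s t).toReal) * (t - s) ^ (1 / p)) := by
  have hp0 : 0 < p := by linarith
  have hp2 : 0 < p / 2 := by positivity
  have fX := (qVar_mono hp0 hs hst ht).trans_lt hX.controlled.path.2
  have fγ := (qVar_mono hp2 hs hst ht).trans_lt hγ.2
  have fR := (qVar_mono hp2 hs hst ht).trans_lt hX.controlled.remainder
  have bY' := qVar_compDeriv_le hp hst hσ hσ fX fγ
  have bRY := qVar_pathRemainder_comp_le hp hst hσ fX fγ fR
  have fY' := bY'.trans_lt ENNReal.ofReal_lt_top
  have fRY := bRY.trans_lt ENNReal.ofReal_lt_top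
  have cY' := rootControl_qVar hp0 fY'
  have cRY := rootControl_qVar hp2 fRY
  have bY' := ENNReal.toReal_le_of_le_ofReal (by positivity) bY'
  have bRY := ENNReal.toReal_le_of_le_ofReal (by positivity) bRY
  have hlen : RootControl (p / 2) (fun s t : ℝ => (t - s) ^ (2 / p)) s t := by
    simpa using rootControl_length hp2 s t
  have hSpos := sewingConst_pos (show 0 < p / 3 by positivity) (by linarith)
  have hS : 0 ≤ M * (1 + d ^ 2) * sewingConst (p / 3) * 4 := by positivity
  have hC1 : 0 ≤ K * T ^ (1 - 2 / p) + d ^ 2 * (K * K * M) := by positivity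
  have hloc : localConst p T M K d = 1 + M * K + (K * T ^ (1 - 2 / p) + d ^ 2 * (K * K * M)) +
    M * (1 + d ^ 2) * sewingConst (p / 3) * 4 * (2 * K ^ 2 + K) := rfl
  have hpt : ∀ u v, s ≤ u → u ≤ v → v ≤ t → _ := fun u v hu huv hv =>
    hX.norm_pathRemainder_le hp hp3 hb hσ hζ hM hγ (hs.trans hu) huv (hv.trans ht)
      ((qVar_mono hp0 hu huv hv).trans_lt fY') ((qVar_mono hp2 hu huv hv).trans_lt fRY)
  set S := M * (1 + d ^ 2) * sewingConst (p / 3) * 4 with hSdef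
  set C₁ := K * T ^ (1 - 2 / p) + d ^ 2 * (K * K * M) with hC1def
  set x := (qVar p (pathIncr X) s t).toReal
  set g := (qVar (p / 2) (pathIncr γ) s t).toReal
  set r := (qVar (p / 2) (pathRemainder ζ X (compPath σ X γ)) s t).toReal
  set y := (qVar p (pathIncr (compDeriv σ X (compPath σ X γ) γ)) s t).toReal with hy
  have hx0 : 0 ≤ x := ENNReal.toReal_nonneg
  have hg0 : 0 ≤ g := ENNReal.toReal_nonneg
  have hr0 : 0 ≤ r := ENNReal.toReal_nonneg
  have hy0 : 0 ≤ y := ENNReal.toReal_nonneg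
  have hl1 : 0 ≤ (t - s) ^ (1 / p) := Real.rpow_nonneg (by linarith) _
  have hl2 : 0 ≤ (t - s) ^ (2 / p) := Real.rpow_nonneg (by linarith) _
  have c1 := hlen.const_mul (add_nonneg hC1 (mul_nonneg hS hy0))
  have c2 := cRY.const_mul (mul_nonneg hS hl1)
  have key := qVar_toReal_le hp2
    (add_nonneg (c1.nonneg s t le_rfl hst le_rfl) (c2.nonneg s t le_rfl hst le_rfl))
    ((c1.variationLE.add (by linarith) (c1.nonneg s t le_rfl hst le_rfl)
      (c2.nonneg s t le_rfl hst le_rfl) c1.nonneg c2.nonneg c2.variationLE).mono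
      (f := fun u v => ‖pathRemainder ζ X (compPath σ X γ) u v‖) hp2
      fun u v hu huv hv => ⟨norm_nonneg _, (hpt u v hu huv hv).trans ?_⟩)
  · refine key.trans ?_
    have m1 : (C₁ + S * y) * (t - s) ^ (2 / p) ≤
        (C₁ + S * (2 * K ^ 2 * (x + g))) * (t - s) ^ (2 / p) := by gcongr
    have m2 := mul_le_mul_of_nonneg_left bRY (mul_nonneg hS hl1)
    refine (add_le_add m1 m2).trans ?_
    have k1 : C₁ + S * (2 * K ^ 2 * (x + g)) ≤ localConst p T M K d * (1 + x + g) := by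
      rw [hloc]
      have : 0 ≤ (1 + M * K) * (1 + x + g) + C₁ * (x + g) + S * (2 * K ^ 2) +
          S * K * (1 + x + g) := by
        positivity
      linarith
    have k2 : S * K ≤ localConst p T M K d := by
      rw [hloc]
      have : 0 ≤ 1 + M * K + C₁ + S * (2 * K ^ 2) := by positivity
      linarith
    have k3 := mul_le_mul_of_nonneg_right k1 hl2
    have k4 : S * K * ((x ^ 2 + r + g) * (t - s) ^ (1 / p)) ≤
        localConst p T M K d * ((x ^ 2 + r + g) * (t - s) ^ (1 / p)) := by gcongr
    linarith
  · have mY : (qVar p (pathIncr (compDeriv σ X (compPath σ X γ) γ)) u v).toReal ≤ y :=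
      cY'.le hp0 le_rfl hu huv hv le_rfl
    have ml : (v - u) ^ (1 / p) ≤ (t - s) ^ (1 / p) :=
      Real.rpow_le_rpow (by linarith) (by linarith) (by positivity)
    have l2 : 0 ≤ (v - u) ^ (2 / p) := Real.rpow_nonneg (by linarith) _
    have a1 := mul_le_mul_of_nonneg_left (mul_le_mul_of_nonneg_right mY l2) hS
    have a2 := mul_le_mul_of_nonneg_left (mul_le_mul_of_nonneg_left ml
      (cRY.nonneg u v hu huv hv)) hS
    linarith

end Local

/-! ### From local to global bounds -/

section Global

/-- On subintervals of `[0, T]` of length at most `h`, the path `X` is `α`-Hölder continuous with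
constant `B`. -/
def HolderUpTo {E : Type*} [NormedAddCommGroup E] (α T : ℝ) (X : ℝ → E) (B h : ℝ) : Prop :=
  ∀ s t, 0 ≤ s → s ≤ t → t ≤ T → t - s ≤ h → ‖pathIncr X s t‖ ≤ B * (t - s) ^ α

variable {E : Type*} [NormedAddCommGroup E] {X : ℝ → E} {α T B B' h h' : ℝ}

lemma HolderUpTo.mono (H : HolderUpTo α T X B h) (hB : B ≤ B') (hh : h' ≤ h) :
    HolderUpTo α T X B' h' := fun s t hs hst ht hle =>
  (H s t hs hst ht (hle.trans hh)).trans
    (mul_le_mul_of_nonneg_right hB (Real.rpow_nonneg (by linarith) _))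

lemma norm_pathIncr_add_le (X : ℝ → E) (s u t : ℝ) :
    ‖pathIncr X s t‖ ≤ ‖pathIncr X s u‖ + ‖pathIncr X u t‖ := by
  have : pathIncr X s t = pathIncr X s u + pathIncr X u t := by simp [pathIncr]
  rw [this]
  exact norm_add_le _ _

lemma HolderUpTo.double (hα : 0 ≤ α) (hB : 0 ≤ B) (H : HolderUpTo α T X B (h / 2)) :
    HolderUpTo α T X (2 * B) h := by
  intro s t hs hst ht hle
  have h1 := H s ((s + t) / 2) hs (by linarith) (by linarith) (by linarith)
  have h2 := H ((s + t) / 2) t (by linarith) (by linarith) ht (by linarith)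
  have e1 : ((s + t) / 2 - s) ^ α ≤ (t - s) ^ α :=
    Real.rpow_le_rpow (by linarith) (by linarith) hα
  have e2 : (t - (s + t) / 2) ^ α ≤ (t - s) ^ α :=
    Real.rpow_le_rpow (by linarith) (by linarith) hα
  have := mul_le_mul_of_nonneg_left e1 hB
  have := mul_le_mul_of_nonneg_left e2 hB
  linarith [norm_pathIncr_add_le X s ((s + t) / 2) t]

/-- A continuity argument in the length of the interval. The quadratic inequality `step` improves
the Hölder constant `4 * C * g` to `2 * C * g` on short intervals; since doubling the length at most
doubles the Hölder constant, the bound `2 * C * g`, which holds for very short intervals because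
*some* Hölder bound is available, propagates up to the length `h`. -/
theorem HolderUpTo.bootstrap {C g h₀ H₀ : ℝ} (hα : 0 < α) (hC : 0 < C) (hg : 0 < g)
    (hH₀ : 0 ≤ H₀) (H : HolderUpTo α T X H₀ h₀)
    (step : ∀ B h, 0 ≤ B → 0 < h → h ≤ h₀ → HolderUpTo α T X B h →
      HolderUpTo α T X (C * (g + B ^ 2 * (h ^ α) ^ 2)) h)
    (hh : 0 < h) (hle : h ≤ h₀) (hsmall : 16 * C ^ 2 * g * (h ^ α) ^ 2 ≤ 1) :
    HolderUpTo α T X (2 * C * g) h := by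
  set δ : ℝ := (Real.sqrt g / (H₀ + 1)) ^ (1 / α) with hδ
  have hδ0 : 0 < δ := Real.rpow_pos_of_pos (by positivity) _
  have hδα : H₀ ^ 2 * (δ ^ α) ^ 2 ≤ g := by
    rw [hδ, ← Real.rpow_mul (by positivity), one_div_mul_cancel hα.ne', Real.rpow_one, div_pow,
      Real.sq_sqrt hg.le, mul_div_assoc', div_le_iff₀ (by positivity)]
    nlinarith
  obtain ⟨n, hn⟩ := pow_unbounded_of_one_lt (h / δ) (one_lt_two (α := ℝ))
  have hnδ : h / 2 ^ n ≤ δ := by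
    rw [div_lt_iff₀ hδ0] at hn
    rw [div_le_iff₀ (by positivity)]
    linarith
  have hdiv : ∀ j : ℕ, h / 2 ^ j ≤ h := fun j => div_le_self hh.le (one_le_pow₀ one_le_two)
  have base : HolderUpTo α T X (2 * C * g) (h / 2 ^ n) := by
    refine (step H₀ (h / 2 ^ n) hH₀ (by positivity) ((hdiv n).trans hle)
      (H.mono le_rfl ((hdiv n).trans hle))).mono ?_ le_rfl
    have h1 : (h / 2 ^ n) ^ α ≤ δ ^ α := Real.rpow_le_rpow (by positivity) hnδ hα.le
    have h2 : H₀ ^ 2 * ((h / 2 ^ n) ^ α) ^ 2 ≤ H₀ ^ 2 * (δ ^ α) ^ 2 := by gcongr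
    calc _ ≤ C * (g + g) := by
          gcongr
          exact h2.trans hδα
      _ = 2 * C * g := by ring
  have down : ∀ j : ℕ, HolderUpTo α T X (2 * C * g) (h / 2 ^ j) →
      HolderUpTo α T X (2 * C * g) h := by
    intro j
    induction j with
    | zero => simp
    | succ j ih =>
      intro hj
      refine ih ?_
      have hd : HolderUpTo α T X (2 * (2 * C * g)) (h / 2 ^ j) := by
        refine HolderUpTo.double hα.le (by positivity) ?_
        rwa [div_div, ← pow_succ]
      refine (step _ _ (by positivity) (by positivity) ((hdiv j).trans hle) hd).mono ?_ le_rfl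
      have h1 : (h / 2 ^ j) ^ α ≤ h ^ α := Real.rpow_le_rpow (by positivity) (hdiv j) hα.le
      have h2 : (2 * (2 * C * g)) ^ 2 * ((h / 2 ^ j) ^ α) ^ 2 ≤ g := by
        calc _ ≤ (2 * (2 * C * g)) ^ 2 * (h ^ α) ^ 2 := by gcongr
          _ = g * (16 * C ^ 2 * g * (h ^ α) ^ 2) := by ring
          _ ≤ g * 1 := by gcongr
          _ = g := mul_one g
      calc _ ≤ C * (g + g) := by gcongr
        _ = 2 * C * g := by ring
  exact down n base

/-- A Hölder bound on short intervals yields one on all of `[0, T]`, by subdivision. -/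
lemma HolderUpTo.global (hα1 : α ≤ 1) (hB : 0 ≤ B) (hh : 0 < h) (hα : 0 < α)
    (H : HolderUpTo α T X B h) : HolderUpTo α T X (B * (1 + 2 * (T / h) ^ (1 - α))) T := by
  have steps : ∀ N : ℕ, ∀ s t, 0 ≤ s → s ≤ t → t ≤ T → t - s ≤ N * h →
      ‖pathIncr X s t‖ ≤ N * (B * h ^ α) := by
    intro N
    induction N with
    | zero =>
      intro s t hs hst ht hle
      obtain rfl : s = t := by
        have : t - s ≤ 0 := by simpa using hle
        linarith
      simp [pathIncr]
    | succ N ih =>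
      intro s t hs hst ht hle
      push_cast at hle ⊢
      set u := min (s + h) t with hu
      have hsu : s ≤ u := le_min (by linarith) hst
      have hut : u ≤ t := min_le_right _ _
      have hus : u - s ≤ h := by linarith [min_le_left (s + h) t]
      have htu : t - u ≤ N * h := by
        rcases min_cases (s + h) t with ⟨h1, _⟩ | ⟨h1, _⟩
        · rw [hu, h1]
          linarith
        · rw [hu, h1, sub_self]
          positivity
      have h1 := H s u hs hsu (by linarith) hus
      have h2 := ih u t (by linarith) hut ht htu
      have h3 : (u - s) ^ α ≤ h ^ α := Real.rpow_le_rpow (by linarith) hus hα.le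
      have := mul_le_mul_of_nonneg_left h3 hB
      linarith [norm_pathIncr_add_le X s u t]
  intro s t hs hst ht _
  have hl0 : 0 ≤ (t - s) ^ α := Real.rpow_nonneg (by linarith) _
  have hTh : 0 ≤ (T / h) ^ (1 - α) := Real.rpow_nonneg (div_nonneg (by linarith) hh.le) _
  rcases le_or_gt (t - s) h with hle | hlt
  · refine (H s t hs hst ht hle).trans (mul_le_mul_of_nonneg_right ?_ hl0)
    exact le_mul_of_one_le_right hB (by linarith)
  · have hpos : 0 < t - s := by linarith
    have h1 := steps ⌈(t - s) / h⌉₊ s t hs hst ht (by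
      have := Nat.le_ceil ((t - s) / h)
      rwa [div_le_iff₀ hh] at this)
    have h2 : (⌈(t - s) / h⌉₊ : ℝ) ≤ 2 * ((t - s) / h) := by
      have := (Nat.ceil_lt_add_one (div_nonneg hpos.le hh.le)).le
      have : 1 ≤ (t - s) / h := (one_le_div hh).mpr hlt.le
      linarith
    have h3 : (t - s) / h * h ^ α = ((t - s) / h) ^ (1 - α) * (t - s) ^ α := by
      have hq : 0 < (t - s) / h := by positivity
      calc (t - s) / h * h ^ α = ((t - s) / h) ^ (1 - α) * ((t - s) / h) ^ α * h ^ α := by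
            rw [← Real.rpow_add hq, sub_add_cancel, Real.rpow_one]
        _ = _ := by
            rw [mul_assoc, ← Real.mul_rpow hq.le hh.le, div_mul_cancel₀ _ hh.ne']
    have h4 : ((t - s) / h) ^ (1 - α) ≤ (T / h) ^ (1 - α) :=
      Real.rpow_le_rpow (by positivity) (by gcongr) (by linarith)
    calc ‖pathIncr X s t‖ ≤ 2 * ((t - s) / h) * (B * h ^ α) := h1.trans (by gcongr)
      _ = B * (2 * ((t - s) / h * h ^ α)) := by ring
      _ = B * (2 * ((t - s) / h) ^ (1 - α)) * (t - s) ^ α := by rw [h3]; ring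
      _ ≤ _ := by
          gcongr
          linarith

lemma HolderUpTo.qVar_le {p s t : ℝ} (hp : 0 < p) (hB : 0 ≤ B) (hs : 0 ≤ s) (hst : s ≤ t)
    (ht : t ≤ T) (hle : t - s ≤ h) (H : HolderUpTo (1 / p) T X B h) :
    (qVar p (pathIncr X) s t).toReal ≤ B * (t - s) ^ (1 / p) := by
  have c := (rootControl_length hp s t).const_mul hB
  refine qVar_toReal_le hp (c.nonneg s t le_rfl hst le_rfl) (c.variationLE.mono hp
    fun u v hu huv hv => ⟨norm_nonneg _, H u v (by linarith) huv (by linarith) (by linarith)⟩)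

end Global

section APriori

/-- The properties of a solution `X` with remainder `R` and driving signal `γ` from which the
a priori bounds follow: `X` and `R` differ by a `1/p`-Hölder function, and the variation of `R`
over subintervals satisfies a quadratic inequality. -/
structure LocalBounds {E G : Type*} [NormedAddCommGroup E] [NormedAddCommGroup G] (p T c₀ : ℝ)
    (X : ℝ → E) (R : ℝ → ℝ → E) (γ : ℝ → G) : Prop where
  path_lt_top : qVar p (pathIncr X) 0 T < ⊤
  remainder_lt_top : qVar (p / 2) R 0 T < ⊤
  signal_lt_top : qVar (p / 2) (pathIncr γ) 0 T < ⊤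
  norm_sub_le : ∀ s t, 0 ≤ s → s ≤ t → t ≤ T →
    ‖pathIncr X s t - R s t‖ ≤ c₀ * (t - s) ^ (1 / p)
  remainder_le : ∀ s t, 0 ≤ s → s ≤ t → t ≤ T → (qVar (p / 2) R s t).toReal ≤
    c₀ * ((1 + (qVar p (pathIncr X) s t).toReal + (qVar (p / 2) (pathIncr γ) s t).toReal) *
      (t - s) ^ (2 / p) + ((qVar p (pathIncr X) s t).toReal ^ 2 + (qVar (p / 2) R s t).toReal +
        (qVar (p / 2) (pathIncr γ) s t).toReal) * (t - s) ^ (1 / p))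

/-- Absorption of the remainder `r` on an interval of length `τ ^ p`. -/
lemma le_of_quadratic_le {c₀ x g r τ : ℝ} (hc₀ : 1 ≤ c₀) (hg : 0 ≤ g) (hr : 0 ≤ r) (hτ : 0 ≤ τ)
    (hτc : τ * (2 * c₀) ≤ 1) (h : r ≤ c₀ * ((1 + x + g) * τ ^ 2 + (x ^ 2 + r + g) * τ)) :
    r ≤ 4 * c₀ * (τ ^ 2 + (x ^ 2 + g) * τ) := by
  have hc0 : 0 ≤ c₀ := by linarith
  have hτ1 : τ ≤ 1 := (le_mul_of_one_le_right hτ (by linarith)).trans hτc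
  have e1 := mul_le_mul_of_nonneg_left hτc hr
  have e2 : τ ^ 2 ≤ τ := by
    rw [sq]
    exact mul_le_of_le_one_left hτ hτ1
  have e3 : (1 + x + g) * τ ^ 2 ≤ (2 + x ^ 2 + g) * τ ^ 2 :=
    mul_le_mul_of_nonneg_right (by nlinarith [sq_nonneg (x - 1)]) (sq_nonneg τ)
  have e4 : (x ^ 2 + g) * τ ^ 2 ≤ (x ^ 2 + g) * τ := by gcongr
  have e5 : c₀ * ((1 + x + g) * τ ^ 2) ≤ c₀ * (2 * τ ^ 2 + (x ^ 2 + g) * τ) :=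
    mul_le_mul_of_nonneg_left (by linarith) hc0
  linarith

/-- The length of the intervals on which the remainder can be absorbed. -/
noncomputable def absorbLength (p c₀ : ℝ) : ℝ := (1 / (2 * c₀)) ^ p

lemma absorbLength_pos {p c₀ : ℝ} (hc₀ : 1 ≤ c₀) : 0 < absorbLength p c₀ :=
  Real.rpow_pos_of_pos (by positivity) _

lemma absorbLength_root {p c₀ : ℝ} (hp : 0 < p) (hc₀ : 1 ≤ c₀) :
    absorbLength p c₀ ^ (1 / p) = 1 / (2 * c₀) := by
  rw [absorbLength, ← Real.rpow_mul (by positivity), mul_one_div_cancel hp.ne', Real.rpow_one]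

lemma rpow_two_div {p z : ℝ} (hz : 0 ≤ z) : z ^ (2 / p) = (z ^ (1 / p)) ^ 2 := by
  rw [← Real.rpow_natCast, ← Real.rpow_mul hz]
  congr 1
  push_cast
  ring

/-- The constant in the a priori bound for the path. -/
noncomputable def pathConst (p T c₀ : ℝ) : ℝ :=
  10 * c₀ * (1 + 2 * (T ^ (1 - 1 / p) * (400 * c₀ ^ 2) ^ ((p - 1) / 2))) * T ^ (1 / p)

/-- The constant in the a priori bound for the remainder. -/
noncomputable def remainderConst (p T c₀ : ℝ) : ℝ :=
  4 * c₀ ^ 2 * (1 + pathConst p T c₀) * T ^ (2 / p) + 4 * c₀ * (pathConst p T c₀ ^ 2 + 1)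

lemma pathConst_nonneg {p T c₀ : ℝ} (hT : 0 < T) (hc₀ : 1 ≤ c₀) : 0 ≤ pathConst p T c₀ := by
  have : 0 < c₀ := by linarith
  rw [pathConst]
  positivity

lemma remainderConst_nonneg {p T c₀ : ℝ} (hT : 0 < T) (hc₀ : 1 ≤ c₀) :
    0 ≤ remainderConst p T c₀ := by
  have : 0 < c₀ := by linarith
  have := pathConst_nonneg (p := p) hT hc₀
  rw [remainderConst]
  positivity

namespace LocalBounds

variable {E G : Type*} [NormedAddCommGroup E] [NormedAddCommGroup G] {p T c₀ : ℝ}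
  {X : ℝ → E} {R : ℝ → ℝ → E} {γ : ℝ → G}

lemma remainder_le_of_short (H : LocalBounds p T c₀ X R γ) (hp : 0 < p) (hc₀ : 1 ≤ c₀)
    {s t : ℝ} (hs : 0 ≤ s) (hst : s ≤ t) (ht : t ≤ T) (hle : t - s ≤ absorbLength p c₀) :
    (qVar (p / 2) R s t).toReal ≤ 4 * c₀ * (((t - s) ^ (1 / p)) ^ 2 +
      ((qVar p (pathIncr X) s t).toReal ^ 2 + (qVar (p / 2) (pathIncr γ) s t).toReal) *
        (t - s) ^ (1 / p)) ∧ (t - s) ^ (1 / p) ≤ 1 := by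
  have key := H.remainder_le s t hs hst ht
  rw [rpow_two_div (by linarith)] at key
  have τ0 : 0 ≤ (t - s) ^ (1 / p) := Real.rpow_nonneg (by linarith) _
  have τ1 : (t - s) ^ (1 / p) ≤ 1 / (2 * c₀) := by
    rw [← absorbLength_root hp hc₀]
    exact Real.rpow_le_rpow (by linarith) hle (by positivity)
  refine ⟨le_of_quadratic_le hc₀ ENNReal.toReal_nonneg ENNReal.toReal_nonneg τ0 ?_ key,
    τ1.trans ?_⟩
  · rwa [le_div_iff₀ (by positivity)] at τ1
  · rw [div_le_one (by positivity)]
    linarith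

lemma norm_pathIncr_le_of_short (H : LocalBounds p T c₀ X R γ) (hp : 0 < p) (hc₀ : 1 ≤ c₀)
    {s t : ℝ} (hs : 0 ≤ s) (hst : s ≤ t) (ht : t ≤ T) (hle : t - s ≤ absorbLength p c₀) :
    ‖pathIncr X s t‖ ≤ 5 * c₀ * (1 + (qVar (p / 2) (pathIncr γ) 0 T).toReal +
      (qVar p (pathIncr X) s t).toReal ^ 2) * (t - s) ^ (1 / p) := by
  obtain ⟨key, τ1⟩ := H.remainder_le_of_short hp hc₀ hs hst ht hle
  have gm : (qVar (p / 2) (pathIncr γ) s t).toReal ≤ (qVar (p / 2) (pathIncr γ) 0 T).toReal :=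
    (rootControl_qVar (by positivity) H.signal_lt_top).le (by positivity) le_rfl hs hst ht le_rfl
  have g0 : 0 ≤ (qVar (p / 2) (pathIncr γ) 0 T).toReal := ENNReal.toReal_nonneg
  have h1 := H.norm_sub_le s t hs hst ht
  have h2 := norm_le_qVar (by positivity) H.remainder_lt_top hs hst ht
  have h3 : ‖pathIncr X s t‖ ≤ ‖pathIncr X s t - R s t‖ + ‖R s t‖ := by
    simpa using norm_add_le (pathIncr X s t - R s t) (R s t)
  have τ0 : 0 ≤ (t - s) ^ (1 / p) := Real.rpow_nonneg (by linarith) _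
  generalize (qVar (p / 2) (pathIncr γ) 0 T).toReal = g at *
  generalize (qVar (p / 2) (pathIncr γ) s t).toReal = g' at *
  generalize (qVar p (pathIncr X) s t).toReal = x at *
  generalize (t - s) ^ (1 / p) = τ at *
  have e2 : τ ^ 2 ≤ τ := by
    rw [sq]
    exact mul_le_of_le_one_left τ0 τ1
  have e3 : 4 * c₀ * (τ ^ 2 + (x ^ 2 + g') * τ) ≤ 4 * c₀ * (τ + (x ^ 2 + g) * τ) := by gcongr
  have e4 : 0 ≤ c₀ * ((g + x ^ 2) * τ) := by positivity
  linarith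

/-- The a priori bound for the path. The quadratic inequality closes on intervals of length
comparable to `(1 + ‖γ‖) ^ (-p / 2)`, where `X` has Hölder constant comparable to `1 + ‖γ‖`;
concatenating these intervals costs a factor comparable to `(1 + ‖γ‖) ^ ((p - 1) / 2)`. -/
theorem path_le (H : LocalBounds p T c₀ X R γ) (hp : 2 ≤ p) (hT : 0 < T) (hc₀ : 1 ≤ c₀) :
    (qVar p (pathIncr X) 0 T).toReal ≤
      pathConst p T c₀ * (1 + (qVar (p / 2) (pathIncr γ) 0 T).toReal) ^ ((p + 1) / 2) := by
  have hp0 : 0 < p := by linarith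
  have hp2 : 0 < p / 2 := by positivity
  have hc0 : 0 < c₀ := by linarith
  have cX := rootControl_qVar hp0 H.path_lt_top
  have short := fun s t => H.norm_pathIncr_le_of_short hp0 hc₀ (s := s) (t := t)
  have g0 : 0 ≤ (qVar (p / 2) (pathIncr γ) 0 T).toReal := ENNReal.toReal_nonneg
  set g₁ : ℝ := 1 + (qVar (p / 2) (pathIncr γ) 0 T).toReal with hg₁
  have hg₁1 : 1 ≤ g₁ := by linarith
  have hg₁0 : 0 < g₁ := by linarith
  set x : ℝ → ℝ → ℝ := fun s t => (qVar p (pathIncr X) s t).toReal with hx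
  change x 0 T ≤ _
  have x0 : 0 ≤ x 0 T := ENNReal.toReal_nonneg
  -- `16 * C ^ 2` for the constant `C = 5 * c₀` of the quadratic inequality, so that the smallness
  -- condition of the bootstrap reads `c * g₁ * (h ^ (1 / p)) ^ 2 ≤ 1`.
  set c : ℝ := 400 * c₀ ^ 2 with hc
  have hcpos : 0 < c := by positivity
  set h : ℝ := (1 / (c * g₁)) ^ (p / 2) with hh
  have hhpos : 0 < h := Real.rpow_pos_of_pos (by positivity) _
  have hhroot : (h ^ (1 / p)) ^ 2 = 1 / (c * g₁) := by
    rw [← rpow_two_div hhpos.le, hh, ← Real.rpow_mul (by positivity),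
      show p / 2 * (2 / p) = 1 by field_simp, Real.rpow_one]
  have hhle : h ≤ absorbLength p c₀ := by
    have e : absorbLength p c₀ = ((1 / (2 * c₀)) ^ 2) ^ (p / 2) := by
      rw [absorbLength, ← Real.rpow_natCast, ← Real.rpow_mul (by positivity)]
      congr 1
      push_cast
      ring
    rw [e]
    refine Real.rpow_le_rpow (by positivity) ?_ hp2.le
    rw [div_pow, one_pow]
    refine one_div_le_one_div_of_le (by positivity) ?_
    calc (2 * c₀) ^ 2 ≤ c * 1 := by nlinarith [sq_nonneg c₀]
      _ ≤ c * g₁ := by gcongr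
  have hold : HolderUpTo (1 / p) T X (2 * (5 * c₀) * g₁) h := by
    refine HolderUpTo.bootstrap (h₀ := absorbLength p c₀) (H₀ := 5 * c₀ * (g₁ + x 0 T ^ 2))
      (by positivity) (by positivity) hg₁0 (by positivity) ?_ ?_ hhpos hhle ?_
    · intro s t hs hst ht hle
      refine (short s t hs hst ht hle).trans
        (mul_le_mul_of_nonneg_right ?_ (Real.rpow_nonneg (by linarith) _))
      have xm : x s t ≤ x 0 T := cX.le hp0 le_rfl hs hst ht le_rfl
      have := cX.nonneg s t hs hst ht
      gcongr
    · intro B h' hB hh' hle' H' s t hs hst ht hle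
      refine (short s t hs hst ht (hle.trans hle')).trans
        (mul_le_mul_of_nonneg_right ?_ (Real.rpow_nonneg (by linarith) _))
      have xb : x s t ≤ B * (t - s) ^ (1 / p) := H'.qVar_le hp0 hB hs hst ht hle
      have := cX.nonneg s t hs hst ht
      have hl : (t - s) ^ (1 / p) ≤ h' ^ (1 / p) :=
        Real.rpow_le_rpow (by linarith) hle (by positivity)
      rw [← mul_pow]
      have xb' : x s t ≤ B * h' ^ (1 / p) := xb.trans (by gcongr)
      gcongr
    · rw [hhroot, hc]
      apply le_of_eq
      field_simp
      norm_num
  have hα1 : 1 / p ≤ 1 := by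
    rw [div_le_one hp0]
    linarith
  have key := (hold.global hα1 (by positivity) hhpos (by positivity)).qVar_le hp0
    (by positivity) le_rfl hT.le le_rfl (by linarith)
  have e1 : (T / h) ^ (1 - 1 / p) =
      T ^ (1 - 1 / p) * c ^ ((p - 1) / 2) * g₁ ^ ((p - 1) / 2) := by
    rw [Real.div_rpow hT.le hhpos.le, hh, ← Real.rpow_mul (by positivity),
      show p / 2 * (1 - 1 / p) = (p - 1) / 2 by field_simp, Real.div_rpow zero_le_one
      (by positivity), Real.one_rpow, Real.mul_rpow hcpos.le hg₁0.le]
    field_simp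
  have e2 : g₁ * g₁ ^ ((p - 1) / 2) = g₁ ^ ((p + 1) / 2) := by
    rw [← Real.rpow_one_add' hg₁0.le (by linarith)]
    congr 1
    ring
  have e3 : 1 ≤ g₁ ^ ((p - 1) / 2) := Real.one_le_rpow hg₁1 (by linarith)
  rw [sub_zero, e1] at key
  rw [pathConst, ← hc]
  set Q : ℝ := T ^ (1 - 1 / p) * c ^ ((p - 1) / 2) with hQ
  have hQ0 : 0 ≤ Q := by positivity
  calc x 0 T ≤ _ := key
    _ ≤ 2 * (5 * c₀) * g₁ * (g₁ ^ ((p - 1) / 2) + 2 * (Q * g₁ ^ ((p - 1) / 2))) *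
          T ^ (1 / p) := by gcongr
    _ = 10 * c₀ * (1 + 2 * Q) * T ^ (1 / p) * (g₁ * g₁ ^ ((p - 1) / 2)) := by ring
    _ = _ := by rw [e2]

/-- A pointwise bound of the remainder valid on intervals of every length: on long intervals a
constant is at most a multiple of `(t - s) ^ (2 / p)`. -/
lemma norm_remainder_le (H : LocalBounds p T c₀ X R γ) (hp : 0 < p) (hc₀ : 1 ≤ c₀)
    {s t : ℝ} (hs : 0 ≤ s) (hst : s ≤ t) (ht : t ≤ T) :
    ‖R s t‖ ≤ 4 * c₀ ^ 2 * (1 + (qVar p (pathIncr X) 0 T).toReal) * (t - s) ^ (2 / p) +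
      4 * c₀ * ((qVar p (pathIncr X) s t).toReal ^ 2 +
        (qVar (p / 2) (pathIncr γ) s t).toReal) := by
  have τ0 : 0 ≤ (t - s) ^ (1 / p) := Real.rpow_nonneg (by linarith) _
  have g0 : 0 ≤ (qVar (p / 2) (pathIncr γ) s t).toReal := ENNReal.toReal_nonneg
  have x0 : 0 ≤ (qVar p (pathIncr X) 0 T).toReal := ENNReal.toReal_nonneg
  rw [rpow_two_div (by linarith)]
  rcases le_or_gt (t - s) (absorbLength p c₀) with hle | hlt
  · obtain ⟨key, τ1⟩ := H.remainder_le_of_short hp hc₀ hs hst ht hle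
    have h2 := norm_le_qVar (by positivity) H.remainder_lt_top hs hst ht
    generalize (qVar (p / 2) (pathIncr γ) s t).toReal = g at *
    generalize (qVar p (pathIncr X) s t).toReal = x at *
    generalize (qVar p (pathIncr X) 0 T).toReal = x' at *
    generalize (t - s) ^ (1 / p) = τ at *
    have e1 : 4 * c₀ * ((x ^ 2 + g) * τ) ≤ 4 * c₀ * ((x ^ 2 + g) * 1) := by gcongr
    have e2 : 4 * c₀ * τ ^ 2 ≤ 4 * c₀ ^ 2 * (1 + x') * τ ^ 2 := by
      refine mul_le_mul_of_nonneg_right ?_ (sq_nonneg τ)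
      have : c₀ * 1 ≤ c₀ * (c₀ * (1 + x')) := by
        gcongr
        nlinarith
      linarith
    linarith
  · have h1 := H.norm_sub_le s t hs hst ht
    have h2 : ‖R s t‖ ≤ ‖pathIncr X s t‖ + ‖pathIncr X s t - R s t‖ := by
      simpa using _root_.norm_sub_le (pathIncr X s t) (pathIncr X s t - R s t)
    have h3 := norm_le_qVar hp H.path_lt_top hs hst ht
    have xm := (rootControl_qVar hp H.path_lt_top).le hp le_rfl hs hst ht le_rfl
    have τ1 : 1 / (2 * c₀) ≤ (t - s) ^ (1 / p) := by
      rw [← absorbLength_root hp hc₀]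
      exact Real.rpow_le_rpow (absorbLength_pos hc₀).le hlt.le (by positivity)
    generalize (qVar (p / 2) (pathIncr γ) s t).toReal = g at *
    generalize (qVar p (pathIncr X) s t).toReal = x at *
    generalize (qVar p (pathIncr X) 0 T).toReal = x' at *
    generalize (t - s) ^ (1 / p) = τ at *
    rw [div_le_iff₀ (by positivity)] at τ1
    have e1 : 1 ≤ (τ * (2 * c₀)) ^ 2 := one_le_pow₀ τ1
    have e2 : x' * 1 ≤ x' * (τ * (2 * c₀)) ^ 2 := by gcongr
    have e3 : c₀ * τ * 1 ≤ c₀ * τ * (τ * (2 * c₀)) := by gcongr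
    have e4 : 0 ≤ 4 * c₀ * (x ^ 2 + g) + 2 * c₀ ^ 2 * τ ^ 2 := by positivity
    linarith

lemma remainder_le_global (H : LocalBounds p T c₀ X R γ) (hp : 2 ≤ p) (hT : 0 < T)
    (hc₀ : 1 ≤ c₀) :
    (qVar (p / 2) R 0 T).toReal ≤
      4 * c₀ ^ 2 * (1 + (qVar p (pathIncr X) 0 T).toReal) * T ^ (2 / p) +
        4 * c₀ * ((qVar p (pathIncr X) 0 T).toReal ^ 2 +
          (qVar (p / 2) (pathIncr γ) 0 T).toReal) := by
  have hp0 : 0 < p := by linarith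
  have hp2 : 0 < p / 2 := by positivity
  have hc0 : 0 ≤ 4 * c₀ := by linarith
  have cX := (rootControl_qVar hp0 H.path_lt_top).sq
  have cγ := rootControl_qVar hp2 H.signal_lt_top
  have hlen : RootControl (p / 2) (fun s t : ℝ => (t - s) ^ (2 / p)) 0 T := by
    simpa using rootControl_length hp2 0 T
  have c1 := hlen.const_mul (k := 4 * c₀ ^ 2 * (1 + (qVar p (pathIncr X) 0 T).toReal))
    (by positivity)
  have k2 := (cX.variationLE.add (by linarith) (cX.nonneg 0 T le_rfl hT.le le_rfl)
    (cγ.nonneg 0 T le_rfl hT.le le_rfl) cX.nonneg cγ.nonneg cγ.variationLE)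
  have n2 := fun s t hs hst ht => add_nonneg (cX.nonneg s t hs hst ht) (cγ.nonneg s t hs hst ht)
  have k3 := k2.const_mul hc0 (n2 0 T le_rfl hT.le le_rfl) n2
  have n3 := fun s t hs hst ht => mul_nonneg hc0 (n2 s t hs hst ht)
  have k4 := c1.variationLE.add (by linarith) (c1.nonneg 0 T le_rfl hT.le le_rfl)
    (n3 0 T le_rfl hT.le le_rfl) c1.nonneg n3 k3
  have := qVar_toReal_le hp2
    (add_nonneg (c1.nonneg 0 T le_rfl hT.le le_rfl) (n3 0 T le_rfl hT.le le_rfl))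
    (k4.mono (f := fun s t => ‖R s t‖) hp2
      fun s t hs hst ht => ⟨norm_nonneg _, H.norm_remainder_le hp0 hc₀ hs hst ht⟩)
  simpa only [sub_zero] using this

/-- The a priori bound for the remainder. -/
theorem remainder_le_signal (H : LocalBounds p T c₀ X R γ) (hp : 2 ≤ p) (hT : 0 < T)
    (hc₀ : 1 ≤ c₀) :
    (qVar (p / 2) R 0 T).toReal ≤
      remainderConst p T c₀ * (1 + (qVar (p / 2) (pathIncr γ) 0 T).toReal) ^ (p + 1) := by
  have hc0 : 0 < c₀ := by linarith
  have hr := H.remainder_le_global hp hT hc₀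
  have hx := H.path_le hp hT hc₀
  have x0 : 0 ≤ (qVar p (pathIncr X) 0 T).toReal := ENNReal.toReal_nonneg
  have g0 : 0 ≤ (qVar (p / 2) (pathIncr γ) 0 T).toReal := ENNReal.toReal_nonneg
  have hD := pathConst_nonneg (p := p) hT hc₀
  rw [remainderConst]
  generalize (qVar (p / 2) (pathIncr γ) 0 T).toReal = g at *
  generalize (qVar p (pathIncr X) 0 T).toReal = x at *
  generalize pathConst p T c₀ = D at *
  have hg₁ : 1 ≤ 1 + g := by linarith
  have e1 : ((1 + g) ^ ((p + 1) / 2)) ^ 2 = (1 + g) ^ (p + 1) := by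
    rw [← Real.rpow_natCast, ← Real.rpow_mul (by linarith)]
    congr 1
    push_cast
    ring
  have e2 : (1 + g) ^ ((p + 1) / 2) ≤ (1 + g) ^ (p + 1) :=
    Real.rpow_le_rpow_of_exponent_le hg₁ (by linarith)
  have e3 : 1 ≤ (1 + g) ^ (p + 1) := Real.one_le_rpow hg₁ (by linarith)
  have e4 : 1 + g ≤ (1 + g) ^ (p + 1) := by
    simpa using Real.rpow_le_rpow_of_exponent_le hg₁ (show (1 : ℝ) ≤ p + 1 by linarith)
  have e5 : x ^ 2 ≤ D ^ 2 * (1 + g) ^ (p + 1) := by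
    rw [← e1, ← mul_pow]
    gcongr
  have e6 : 1 + x ≤ (1 + D) * (1 + g) ^ (p + 1) := by
    have := mul_le_mul_of_nonneg_left e2 hD
    linarith
  have e7 : x ^ 2 + g ≤ (D ^ 2 + 1) * (1 + g) ^ (p + 1) := by linarith
  calc _ ≤ 4 * c₀ ^ 2 * ((1 + D) * (1 + g) ^ (p + 1)) * T ^ (2 / p) +
        4 * c₀ * ((D ^ 2 + 1) * (1 + g) ^ (p + 1)) := hr.trans (by gcongr)
    _ = _ := by ring

end LocalBounds

lemma IsRDESolution.localBounds {m d k : ℕ} {p T : ℝ} {M K : ℝ≥0}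
    {b : RSpace m × RSpace k → RSpace m} {σ : RSpace m × RSpace k → (RSpace d →L[ℝ] RSpace m)}
    {ζ : ℝ → RSpace d} {ζ2 : ℝ → ℝ → RTensor d} {γ : ℝ → RSpace k} {x₀ : RSpace m}
    {X : ℝ → RSpace m} (hp : 2 ≤ p) (hp3 : p < 3) (hT : 0 < T)
    (hb : IsLipBounded K b) (hσ : IsC2Bounded K σ) (hζ : IsRoughPath p T ζ ζ2)
    (hM : roughHolderNorm p T ζ ζ2 ≤ M) (hγ : IsQVarPath (p / 2) T γ)
    (hX : IsRDESolution p T b σ ζ ζ2 γ x₀ X) :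
    LocalBounds p T (localConst p T M K d) X (pathRemainder ζ X (compPath σ X γ)) γ where
  path_lt_top := hX.controlled.path.2
  remainder_lt_top := hX.controlled.remainder
  signal_lt_top := hγ.2
  norm_sub_le _ _ hs hst ht := norm_pathIncr_sub_pathRemainder_le hp hp3 hT hσ hM hs hst ht
  remainder_le _ _ hs hst ht := hX.qVar_pathRemainder_le hp hp3 hT hb hσ hζ hM hγ hs hst ht

end APriori

/-! ### The regularity estimates -/

lemma one_add_rpow_le {g a e : ℝ} (hg : 0 ≤ g) (ha : 0 ≤ e) (hae : a ≤ e) :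
    (1 + g) ^ a ≤ 2 ^ e * (1 + g ^ e) := by
  have hge : 0 ≤ g ^ e := Real.rpow_nonneg hg e
  calc (1 + g) ^ a ≤ (1 + g) ^ e := Real.rpow_le_rpow_of_exponent_le (by linarith) hae
    _ ≤ (2 * max 1 g) ^ e :=
        Real.rpow_le_rpow (by linarith) (by linarith [le_max_left 1 g, le_max_right 1 g]) ha
    _ = 2 ^ e * max 1 g ^ e := Real.mul_rpow two_pos.le (by positivity)
    _ ≤ 2 ^ e * (1 + g ^ e) := by
        gcongr
        rcases max_cases 1 g with ⟨h, _⟩ | ⟨h, _⟩ <;> rw [h]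
        · rw [Real.one_rpow]
          linarith
        · linarith

/-- A polynomial bound between the real values of two finite extended quantities. -/
lemma le_const_mul_one_add_rpow {z g : ℝ≥0∞} {c a e : ℝ} {C : ℝ≥0} (hz : z ≠ ⊤) (hg : g ≠ ⊤)
    (hc : 0 ≤ c) (he : 0 ≤ e) (hae : a ≤ e) (h : z.toReal ≤ c * (1 + g.toReal) ^ a)
    (hC : c * 2 ^ e ≤ C) : z ≤ C * (1 + g ^ e) := by
  have hge : g ^ e ≠ ⊤ := ENNReal.rpow_ne_top_of_nonneg he hg
  have hfin : (C : ℝ≥0∞) * (1 + g ^ e) ≠ ⊤ :=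
    ENNReal.mul_ne_top ENNReal.coe_ne_top (ENNReal.add_ne_top.mpr ⟨ENNReal.one_ne_top, hge⟩)
  rw [← ENNReal.toReal_le_toReal hz hfin, ENNReal.toReal_mul,
    ENNReal.toReal_add ENNReal.one_ne_top hge, ENNReal.coe_toReal, ENNReal.toReal_one,
    ← ENNReal.toReal_rpow]
  have hg0 : 0 ≤ g.toReal ^ e := Real.rpow_nonneg ENNReal.toReal_nonneg _
  calc z.toReal ≤ c * (2 ^ e * (1 + g.toReal ^ e)) :=
        h.trans (mul_le_mul_of_nonneg_left (one_add_rpow_le ENNReal.toReal_nonneg he hae) hc)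
    _ = c * 2 ^ e * (1 + g.toReal ^ e) := by ring
    _ ≤ C * (1 + g.toReal ^ e) := mul_le_mul_of_nonneg_right hC (by linarith)

theorem mainTheorem7 {m d k : ℕ} {W : Type*} [NormedAddCommGroup W] [NormedSpace ℝ W]
    (p T : ℝ) (hp : 2 ≤ p) (hp3 : p < 3) (hT : 0 < T) (M K : ℝ≥0) :
    ∃ C : ℝ≥0, 0 < C ∧
      ∀ (b : RSpace m × RSpace k → RSpace m)
        (σ : RSpace m × RSpace k → (RSpace d →L[ℝ] RSpace m))
        (ψ : RSpace m × RSpace k → W),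
        IsLipBounded K b → IsC2Bounded K σ → IsC2Bounded K ψ →
      ∀ (ζ : ℝ → RSpace d) (ζ2 : ℝ → ℝ → RTensor d),
        IsRoughPath p T ζ ζ2 → roughHolderNorm p T ζ ζ2 ≤ M →
      ∀ γ : ℝ → RSpace k, IsQVarPath (p / 2) T γ →
      ∀ (x₀ : RSpace m) (X : ℝ → RSpace m), IsRDESolution p T b σ ζ ζ2 γ x₀ X →
        qVar p (pathIncr (compDeriv ψ X (compPath σ X γ) γ)) 0 T
            ≤ C * (qVar p (pathIncr X) 0 T + qVar (p / 2) (pathIncr γ) 0 T) ∧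
        qVar (p / 2)
            (pathRemainder ζ (compPath ψ X γ) (compDeriv ψ X (compPath σ X γ) γ)) 0 T
            ≤ C * ((qVar p (pathIncr X) 0 T) ^ 2
                + qVar (p / 2) (pathRemainder ζ X (compPath σ X γ)) 0 T
                + qVar (p / 2) (pathIncr γ) 0 T) ∧
        qVar p (pathIncr X) 0 T
            ≤ C * (1 + (qVar (p / 2) (pathIncr γ) 0 T) ^ (1 + p)) ∧
        qVar (p / 2) (pathRemainder ζ X (compPath σ X γ)) 0 T
            ≤ C * (1 + (qVar (p / 2) (pathIncr γ) 0 T) ^ (2 + p)) := by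
  have hc₀ := one_le_localConst hp hp3 hT M K d
  have hD := pathConst_nonneg (p := p) hT hc₀
  have hD' := remainderConst_nonneg (p := p) hT hc₀
  set c₀ := localConst p T M K d
  set C₃ : ℝ≥0 := Real.toNNReal (pathConst p T c₀ * 2 ^ (1 + p))
  set C₄ : ℝ≥0 := Real.toNNReal (remainderConst p T c₀ * 2 ^ (2 + p))
  refine ⟨1 + 2 * K ^ 2 + K + C₃ + C₄, by positivity, ?_⟩
  intro b σ ψ hb hσ hψ ζ ζ2 hζ hM γ hγ x₀ X hX
  have H := hX.localBounds hp hp3 hT hb hσ hζ hM hγ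
  have fX := hX.controlled.path.2
  have fR := hX.controlled.remainder
  have real_le : ∀ {a c : ℝ≥0}, a ≤ c → ∀ z : ℝ≥0∞, (a : ℝ≥0∞) * z ≤ c * z := fun hac z => by
    gcongr
  refine ⟨?_, ?_, ?_, ?_⟩
  · refine (qVar_compDeriv_le hp hT.le hψ hσ fX hγ.2).trans ?_
    rw [ENNReal.ofReal_mul (by positivity), ENNReal.ofReal_add ENNReal.toReal_nonneg
      ENNReal.toReal_nonneg, ENNReal.ofReal_toReal fX.ne, ENNReal.ofReal_toReal hγ.2.ne,
      show (2 * (K : ℝ) ^ 2) = ((2 * K ^ 2 : ℝ≥0) : ℝ) by push_cast; rfl, ENNReal.ofReal_coe_nnreal]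
    refine real_le ?_ _
    rw [← NNReal.coe_le_coe]
    push_cast
    linarith [K.2, C₃.2, C₄.2]
  · refine (qVar_pathRemainder_comp_le hp hT.le hψ fX hγ.2 fR).trans ?_
    rw [ENNReal.ofReal_mul K.coe_nonneg, ENNReal.ofReal_add (by positivity) ENNReal.toReal_nonneg,
      ENNReal.ofReal_add (by positivity) ENNReal.toReal_nonneg,
      ENNReal.ofReal_pow ENNReal.toReal_nonneg, ENNReal.ofReal_toReal fX.ne,
      ENNReal.ofReal_toReal fR.ne, ENNReal.ofReal_toReal hγ.2.ne, ENNReal.ofReal_coe_nnreal]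
    refine real_le ?_ _
    rw [← NNReal.coe_le_coe]
    push_cast
    linarith [sq_nonneg (K : ℝ), C₃.2, C₄.2]
  · refine le_const_mul_one_add_rpow fX.ne hγ.2.ne hD (by linarith) (by linarith)
      (H.path_le hp hT hc₀) ((Real.le_coe_toNNReal _).trans ?_)
    push_cast
    linarith [sq_nonneg (K : ℝ), K.2, C₄.2]
  · refine le_const_mul_one_add_rpow fR.ne hγ.2.ne hD' (by linarith) (by linarith)
      (H.remainder_le_signal hp hT hc₀) ((Real.le_coe_toNNReal _).trans ?_)
    push_cast
    linarith [sq_nonneg (K : ℝ), K.2, C₃.2]
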